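/- **Theorem 4.1 (asymptotic convergence of the regularized distributed incremental projection method).** *Setting.* Let $m\ge1$, $\mathbb R^n=\mathbb R^{n_1}\times\cdots\times\mathbb R^{n_m}$ with the Euclidean inner product, and let $(\Omega,\mathcal F,\mathbb P)$ be a probability space. Let $v=(v_1,\dots,v_m)$ be a random variable with values in a measurable space $\Xi=\Xi_1\times\cdots\times\Xi_m$, let $F_j:\Xi_j\times\mathbb R^n\to\mathbb R^{n_j}$ be measurable, $F(v,x)=(F_1(v_1,x),\dots,F_m(v_m,x))$ integrable for every $x\in\mathbb R^n$, and $T(x):=\mathbb E[F(v,x)]$. Let $X=X^1\times\cdots\times X^m$ with $$X^j=X^j_0\cap\bigcap_{i\in\mathcal I_j}X^j_i,\qquad X^j_i=\{x\in\mathbb R^{n_j}: g_i(j|x)\le 0\},$$ where $X^j_0$ and all $X^j_i$ are closed and convex, the $g_i(j|\cdot):\mathbb R^{n_j}\to\mathbb R\cup\{\infty\}$ are convex, $\mathcal I_j$ is a measurable space and $i\mapsto g_i(j|x)$ is measurable for every $x\in X_0^j$. With $g_i^+:=\max\{g_i,0\}$, assume that for every $j$, $i\in\mathcal I_j$ and $x\in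 X^j_0$ the subdifferential $\partial g^+_i(j|x)$ is nonempty (in particular $g_i(j|x)<\infty$), and that for every $j$ there is $C^j_g>0$ with $\|d\|\le C^j_g$ for all $i\in\mathcal I_j$, $x\in X_0^j$, $d\in\partial g_i^+(j|x)$. *Method.* Let $x^0\in\mathbb R^n$, let $\alpha_{k,j}>0$, $\beta_{k,j}\in(0,2)$ for $k\ge0$ and $\epsilon_{k,j}>0$ for $k\ge-1$, let $v^k$ be random variables with values in $\Xi$ and $\omega^k=(\omega_{k,1},\dots,\omega_{k,m})$ random variables with values in $\mathcal I_1\times\cdots\times\mathcal I_m$ $(k\ge 0)$, and put $\mathcal F_k=\sigma(\omega^0,\dots,\omega^{k-1},v^0,\dots,v^{k-1})$. For $k\ge0$ and $j=1,\dots,m$ define $$y^k_j=\Pi_{X_0^j}\big[x^k_j-\alpha_{k,j}\big(F_j(v^k_j,x^k)+\epsilon_{k,j}x^k_j\big)\big],\qquad x^{k+1}_j=\Pi_{X_0^j}\Big[y^k_j-\beta_{k,j}\frac{g^+_{\omega_{k,j}}(j|y^k_j)}{\|d^k_j\|^2}d^k_j\Big],$$ where $\Pi_C$ is the orthogonal projection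 onto $C$, $d^k_j\ne0$, $d^k_j\in\partial g^+_{\omega_{k,j}}(j|y^k_j)$ if $g_{\omega_{k,j}}(j|y^k_j)>0$, and $d^k$ is $\mathcal F_{k+1}$-measurable. *Assumptions.* 1. The set $X^*$ of all $x^*\in X$ with $\langle T(x^*),x-x^*\rangle\ge0$ for all $x\in X$ is nonempty. 2. $\langle T(y)-T(x),y-x\rangle\ge0$ for all $x,y\in\mathbb R^n$. 3. There is a measurable $L:\Xi\to[0,\infty)$ with $\mathbb E[L(v)^2]<\infty$ such that a.s. $\|F(v,y)-F(v,x)\|\le L(v)\|y-x\|$ for all $x,y\in\mathbb R^n$; moreover $\mathbb E[\|F(v,x)\|^2]<\infty$ for every $x\in X$. 4. $(v^k)_{k\ge0}$ are i.i.d. copies of $v$, and $v^k$ is independent of $\mathcal F_k$ for every $k$. 5. For each $j$ there is $c^j>0$ such that, for all $k\ge0$ and $x\in X_0^j$, a.s. $\operatorname{dist}(x,X^j)^2\le c^j\,\mathbb E\big[\big(g^+_{\omega_{k,j}}(j|x)\big)^2\,\big|\,\mathcal F_k\big]$. 6. Write $u_{k,\min}=\min_ju_{k,j}$, $u_{k,\max}=\max_ju_{k,j}$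 for $u\in\{\alpha,\beta,\epsilon\}$, $\Delta_k=\alpha_{k,\max}-\alpha_{k,\min}$, $\Gamma_k=\epsilon_{k-1,\max}-\epsilon_{k,\min}$, $\mathsf B_k=\beta_{k,\min}(2-\beta_{k,\max})$. For each $j$ the sequence $(\epsilon_{k,j})_{k\ge-1}$ is nonincreasing and tends to $0$; as $k\to\infty$, $$\frac{\alpha_{k,\max}^2}{\alpha_{k,\min}\epsilon_{k,\min}}\to0,\quad \frac{\alpha_{k,\max}^2}{\mathsf B_k\alpha_{k,\min}\epsilon_{k,\min}}\to0,\quad \frac{\Delta_k}{\alpha_{k,\min}\epsilon_{k,\min}}\to0,\quad \alpha_{k,\min}\epsilon_{k,\min}\to0,$$ $$\frac{\Gamma_k^2}{\epsilon_{k,\min}^3\alpha_{k,\min}}\Big(1+\frac1{\alpha_{k,\min}\epsilon_{k,\min}}\Big)\to0;$$ $\sum_k\alpha_{k,\min}\epsilon_{k,\min}=\infty$; and the series $$\sum_k\alpha_{k,\max}^2,\quad \sum_k\frac{\alpha_{k,\max}^2}{\mathsf B_k},\quad \sum_k\Big(\frac{\Gamma_k}{\epsilon_{k,\min}}\Big)^2\Big(1+\frac1{\alpha_{k,\min}\epsilon_{k,\min}}\Big),\quad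 \sum_k\frac{\Delta_k^2}{\alpha_{k,\min}\epsilon_{k,\min}}$$ converge. *Conclusion.* (i) If $\limsup_{k\to\infty}\epsilon_{k,\max}/\epsilon_{k,\min}<\infty$, then almost surely $(x^k)$ is bounded and all its cluster points belong to $X^*$. (ii) If $\limsup_{k\to\infty}\epsilon_{k,\max}/\epsilon_{k,\min}\le1$, then $X^*$ has a unique element of least norm and almost surely $(x^k)$ converges to it. -/

import Mathlib

open MeasureTheory ProbabilityTheory Filter Topology

noncomputable section

namespace CartesianSVI

/-! ### Convex analysis -/

/-- The positive part `f⁺ = max {f, 0}` of an extended-real-valued function. -/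
def plusPart {E : Type*} (f : E → EReal) (x : E) : EReal := max (f x) 0

/-- A convex function with values in `ℝ ∪ {+∞}`: it never takes the value `-∞` and its epigraph is
convex. -/
def IsConvexFun {E : Type*} [AddCommGroup E] [Module ℝ E] (f : E → EReal) : Prop :=
  (∀ x, f x ≠ ⊥) ∧ Convex ℝ {p : E × ℝ | f p.1 ≤ (p.2 : EReal)}

/-- The subdifferential of `f` at `x`; it is empty where `f` is not finite. -/
def subdiff {E : Type*} [NormedAddCommGroup E] [InnerProductSpace ℝ E]
    (f : E → EReal) (x : E) : Set E :=
  {d | f x ≠ ⊤ ∧ f x ≠ ⊥ ∧ ∀ z, f x + ((inner ℝ d (z - x) : ℝ) : EReal) ≤ f z}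

/-- `p` is the orthogonal projection of `u` onto `C`: the point of `C` nearest to `u` (it exists and
is unique when `C` is a nonempty closed convex subset of a Euclidean space). -/
def IsProj {E : Type*} [PseudoMetricSpace E] (C : Set E) (u p : E) : Prop :=
  p ∈ C ∧ ∀ q ∈ C, dist u p ≤ dist u q

/-- The minimum of a finite family of reals. -/
def rowMin {m : ℕ} (u : Fin m → ℝ) : ℝ := ⨅ j, u j

/-- The maximum of a finite family of reals. -/
def rowMax {m : ℕ} (u : Fin m → ℝ) : ℝ := ⨆ j, u j

/-! ### The variational inequality -/

/-- The solution set of the variational inequality `VI(T, X)`. -/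
def solSet {E : Type*} [NormedAddCommGroup E] [InnerProductSpace ℝ E]
    (T : E → E) (X : Set E) : Set E :=
  {x | x ∈ X ∧ ∀ y ∈ X, 0 ≤ inner ℝ (T x) (y - x)}

/-- `z` is an element of `S` of least norm. -/
def IsLeastNorm {E : Type*} [Norm E] (S : Set E) (z : E) : Prop :=
  z ∈ S ∧ ∀ w ∈ S, ‖z‖ ≤ ‖w‖

/-- The block `ℝ^{n_j}` of agent `j`. -/
abbrev Block {m : ℕ} (n : Fin m → ℕ) (j : Fin m) : Type := EuclideanSpace ℝ (Fin (n j))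

/-- `ℝ^n = ℝ^{n_1} × ⋯ × ℝ^{n_m}` with the inner product `⟨x, y⟩ = ∑ j, ⟨x_j, y_j⟩`. -/
abbrev Prd {m : ℕ} (n : Fin m → ℕ) : Type := PiLp 2 (Block n)

section

variable {m : ℕ} {n : Fin m → ℕ} {Ω : Type*} [MeasurableSpace Ω]
  {Ξ : Fin m → Type*} [∀ j, MeasurableSpace (Ξ j)]
  {I : Fin m → Type*} [∀ j, MeasurableSpace (I j)]

/-- The random operator `F(ξ, x) = (F_1(ξ_1, x), …, F_m(ξ_m, x))`. -/
def fullOp (F : ∀ j, Ξ j → Prd n → Block n j) (ξ : ∀ j, Ξ j) (x : Prd n) : Prd n :=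
  WithLp.toLp 2 (fun j => F j (ξ j) x)

/-- The mean operator `T(x) = 𝔼[F(v, x)]`. -/
def meanOp (P : Measure Ω) (v : Ω → ∀ j, Ξ j) (F : ∀ j, Ξ j → Prd n → Block n j)
    (x : Prd n) : Prd n :=
  ∫ ω, fullOp F (v ω) x ∂P

/-- The feasible set `X^j = X_0^j ∩ ⋂ i, {x | g_i(j | x) ≤ 0}` of agent `j`. -/
def agentSet (X₀ : ∀ j, Set (Block n j)) (g : ∀ j, I j → Block n j → EReal) (j : Fin m) :
    Set (Block n j) :=
  X₀ j ∩ ⋂ i, {x | g j i x ≤ 0}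

/-- The feasible set `X = X^1 × ⋯ × X^m`. -/
def feasSet (X₀ : ∀ j, Set (Block n j)) (g : ∀ j, I j → Block n j → EReal) : Set (Prd n) :=
  {x | ∀ j, x j ∈ agentSet X₀ g j}

/-- `𝓕_k = σ(w⁰, …, w^{k-1}, v⁰, …, v^{k-1})`, where `w` are the random controls and `v` the
operator samples. -/
abbrev history (w : ℕ → Ω → ∀ j, I j) (v : ℕ → Ω → ∀ j, Ξ j) (k : ℕ) : MeasurableSpace Ω :=
  ⨆ (i : ℕ) (_ : i < k),
    MeasurableSpace.comap (w i) MeasurableSpace.pi ⊔ MeasurableSpace.comap (v i) MeasurableSpace.pi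

/-! ### Assumptions -/

/-- The constraint structure: closed convex hard constraints `X_0^j`, closed soft constraints
`{g_i(j | ·) ≤ 0}` with `g_i(j | ·)` convex, depending measurably on the index `i`, and
subgradients of `g_i^+(j | ·)` that exist at every point of `X_0^j` and are bounded there, uniformly
in `i`. -/
structure ConstraintStructure (X₀ : ∀ j, Set (Block n j))
    (g : ∀ j, I j → Block n j → EReal) : Prop where
  closed_hard : ∀ j, IsClosed (X₀ j)
  convex_hard : ∀ j, Convex ℝ (X₀ j)
  convex_soft : ∀ j i, IsConvexFun (g j i)
  closed_soft : ∀ j i, IsClosed {x | g j i x ≤ 0}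
  measurable_soft : ∀ j, ∀ x ∈ X₀ j, Measurable (fun i => g j i x)
  subdiff_nonempty : ∀ j i, ∀ x ∈ X₀ j, (subdiff (plusPart (g j i)) x).Nonempty
  subdiff_bounded : ∀ j, ∃ C > 0, ∀ i, ∀ x ∈ X₀ j, ∀ d ∈ subdiff (plusPart (g j i)) x, ‖d‖ ≤ C

/-- The random operator: `F` is jointly measurable, `F(v, x)` is integrable for every `x` and has
finite variance at the points of the feasible set `X`, `F(v, ·)` is almost surely Lipschitz with a
square-integrable modulus `L(v)`, and the mean operator is monotone. -/
structure OperatorAssumption (P : Measure Ω) (v : Ω → ∀ j, Ξ j)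
    (F : ∀ j, Ξ j → Prd n → Block n j) (X : Set (Prd n)) : Prop where
  measurable_v : Measurable v
  measurable_F : ∀ j, Measurable (fun p : Ξ j × Prd n => F j p.1 p.2)
  integrable : ∀ x, Integrable (fun ω => fullOp F (v ω) x) P
  second_moment : ∀ x ∈ X, MemLp (fun ω => fullOp F (v ω) x) 2 P
  lipschitz : ∃ L : (∀ j, Ξ j) → ℝ, Measurable L ∧ (∀ ξ, 0 ≤ L ξ) ∧
    Integrable (fun ω => L (v ω) ^ 2) P ∧
    ∀ᵐ ω ∂P, ∀ x y, ‖fullOp F (v ω) y - fullOp F (v ω) x‖ ≤ L (v ω) * ‖y - x‖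
  monotone : ∀ x y, 0 ≤ inner ℝ (meanOp P v F y - meanOp P v F x) (y - x)

/-- The samples `v^k` are i.i.d. copies of `v`, and `v^k` is independent of the history `𝓕_k`. -/
structure SamplingAssumption (P : Measure Ω) (v : Ω → ∀ j, Ξ j) (vs : ℕ → Ω → ∀ j, Ξ j)
    (w : ℕ → Ω → ∀ j, I j) : Prop where
  measurable_vs : ∀ k, Measurable (vs k)
  measurable_w : ∀ k, Measurable (w k)
  identDistrib : ∀ k, IdentDistrib (vs k) v P P
  iIndep : iIndepFun vs P
  indep_history : ∀ k, Indep (MeasurableSpace.comap (vs k) MeasurableSpace.pi) (history w vs k) P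

/-- Constraint sampling and regularity:
`dist(x, X^j)² ≤ c^j 𝔼[(g^+_{ω_{k,j}}(j | x))² | 𝓕_k]` almost surely, for `x ∈ X_0^j`. -/
def RegularityAssumption (P : Measure Ω) (X₀ : ∀ j, Set (Block n j))
    (g : ∀ j, I j → Block n j → EReal) (w : ℕ → Ω → ∀ j, I j) (vs : ℕ → Ω → ∀ j, Ξ j) : Prop :=
  ∀ j, ∃ c > 0, ∀ k, ∀ x ∈ X₀ j, ∀ᵐ ω ∂P,
    Metric.infDist x (agentSet X₀ g j) ^ 2 ≤
      c * (P[fun ω' => (plusPart (g j (w k ω' j)) x).toReal ^ 2 | history w vs k]) ω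

end

section

variable {m : ℕ}

/-- `Δ_k = α_{k,max} - α_{k,min}`. -/
def stepGap (α : ℕ → Fin m → ℝ) (k : ℕ) : ℝ := rowMax (α k) - rowMin (α k)

/-- `Γ_k = ε_{k-1,max} - ε_{k,min}`; the regularization parameters are indexed by `k ≥ -1`. -/
def regGap (ε : ℤ → Fin m → ℝ) (k : ℕ) : ℝ := rowMax (ε ((k : ℤ) - 1)) - rowMin (ε k)

/-- `B_k = β_{k,min} (2 - β_{k,max})`. -/
def relaxMin (β : ℕ → Fin m → ℝ) (k : ℕ) : ℝ := rowMin (β k) * (2 - rowMax (β k))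

/-- `α_{k,min} ε_{k,min}`. -/
def stepReg (α : ℕ → Fin m → ℝ) (ε : ℤ → Fin m → ℝ) (k : ℕ) : ℝ := rowMin (α k) * rowMin (ε k)

/-- Partial coordination of the stepsizes `α_{k,j}`, `β_{k,j}` (`k ≥ 0`) and the regularization
parameters `ε_{k,j}` (`k ≥ -1`). -/
structure StepAssumption (α β : ℕ → Fin m → ℝ) (ε : ℤ → Fin m → ℝ) : Prop where
  step_pos : ∀ k j, 0 < α k j
  relax_mem : ∀ k j, 0 < β k j ∧ β k j < 2
  reg_pos : ∀ k : ℤ, -1 ≤ k → ∀ j, 0 < ε k j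
  reg_antitone : ∀ j, AntitoneOn (fun k => ε k j) (Set.Ici (-1))
  reg_tendsto : ∀ j, Tendsto (fun k : ℤ => ε k j) atTop (𝓝 0)
  lim_step : Tendsto (fun k => rowMax (α k) ^ 2 / stepReg α ε k) atTop (𝓝 0)
  lim_relax : Tendsto (fun k => rowMax (α k) ^ 2 / (relaxMin β k * stepReg α ε k)) atTop (𝓝 0)
  lim_gap : Tendsto (fun k => stepGap α k / stepReg α ε k) atTop (𝓝 0)
  lim_stepReg : Tendsto (fun k => stepReg α ε k) atTop (𝓝 0)
  sum_stepReg : Tendsto (fun N => ∑ k ∈ Finset.range N, stepReg α ε k) atTop atTop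
  sum_step : Summable (fun k => rowMax (α k) ^ 2)
  sum_relax : Summable (fun k => rowMax (α k) ^ 2 / relaxMin β k)
  sum_reg : Summable (fun k : ℕ =>
    (regGap ε k / rowMin (ε k)) ^ 2 * (1 + (rowMin (α k))⁻¹ * (rowMin (ε k))⁻¹))
  sum_gap : Summable (fun k => stepGap α k ^ 2 / stepReg α ε k)
  lim_reg : Tendsto (fun k : ℕ => regGap ε k ^ 2 / (rowMin (ε k) ^ 3 * rowMin (α k)) *
    (1 + (rowMin (α k))⁻¹ * (rowMin (ε k))⁻¹)) atTop (𝓝 0)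

end

/-! ### The method -/

section

variable {m : ℕ} {n : Fin m → ℕ} {Ω : Type*}
  {Ξ : Fin m → Type*} [∀ j, MeasurableSpace (Ξ j)]
  {I : Fin m → Type*} [∀ j, MeasurableSpace (I j)]

/-- `x` is a sequence generated by the regularized distributed incremental projection method from
`x0`, with auxiliary iterates `y` and directions `d`. The direction `d^k` is chosen from the
information available after the `k`-th sampling, i.e. it is `𝓕_{k+1}`-measurable. -/
structure IsRun (X₀ : ∀ j, Set (Block n j)) (g : ∀ j, I j → Block n j → EReal)
    (F : ∀ j, Ξ j → Prd n → Block n j) (α β : ℕ → Fin m → ℝ) (ε : ℤ → Fin m → ℝ)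
    (w : ℕ → Ω → ∀ j, I j) (vs : ℕ → Ω → ∀ j, Ξ j) (x0 : Prd n)
    (x y d : ℕ → Ω → Prd n) : Prop where
  init : ∀ ω, x 0 ω = x0
  operator_step : ∀ k ω j,
    IsProj (X₀ j) (x k ω j - α k j • (F j (vs k ω j) (x k ω) + ε k j • x k ω j)) (y k ω j)
  feasibility_step : ∀ k ω j,
    IsProj (X₀ j)
      (y k ω j - (β k j * (plusPart (g j (w k ω j)) (y k ω j)).toReal / ‖d k ω j‖ ^ 2) • d k ω j)
      (x (k + 1) ω j)
  direction_ne_zero : ∀ k ω j, d k ω j ≠ 0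
  direction_mem : ∀ k ω j, 0 < g j (w k ω j) (y k ω j) →
    d k ω j ∈ subdiff (plusPart (g j (w k ω j))) (y k ω j)
  direction_measurable : ∀ k, Measurable[history w vs (k + 1)] (d k)

end

end CartesianSVI

end

open CartesianSVI

namespace CartesianSVI

/-! ### Projections onto convex sets -/

section Projection

variable {E : Type*} [NormedAddCommGroup E] [InnerProductSpace ℝ E] {C : Set E} {u u' p p' q : E}

/-! The iterates are compared with the Tikhonov trajectory: `t k` solves the variational inequality
on `X` for `T + diag(ε k)`, which is strongly monotone and Lipschitz. The theorem splits into a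
deterministic statement about `t` and the probabilistic statement that `x (k + 1) - t k` tends to
`0` almost surely whenever `t` is bounded (`IsRun.ae_tendsto_norm_sub_sq`).

Deterministic side. In the norm weighted by `ε k`, the point `t k` is no longer than any solution
(`norm_sq_le_of_mem_solSet_regOp`). A bounded ratio `ε_max / ε_min` therefore bounds `t`, and
cluster points of `t` solve the unregularized problem. If the limsup of the ratio is at most `1`,
each cluster point has least norm, so `t` converges.

Probabilistic side. One step changes the squared distance to `t k` as follows. Strong monotonicity
contracts it at rate `2 α_min ε_min` (`drift_le`). Unequal stepsizes cost terms in `Δ`, and sampling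
noise costs `α_max²` times quadratic growth. Since iterates may leave `X`, testing the inequality
for `t k` costs `α_min` times the distance to `X`. The randomized feasibility step pays for this:
with regularity it gains a multiple of `B_k dist²` in the mean, so Young's inequality leaves only
`α_max² / B_k`. Moving from `t k` to `t (k + 1)` costs a multiple of `(Γ / ε_min)² (1 + 1 / (α_min
ε_min))`. All residual costs are summable while the contraction rates are not, and
`ae_tendsto_zero_of_almost_supermartingale` concludes.

Conditional inequalities are used in integrated form, over events of the history. Regularity is
assumed only at fixed points; `setIntegral_le_of_le_condExp` carries it to the random iterate. -/

lemma IsProj.inner_le_zero (h : IsProj C u p) (hC : Convex ℝ C) (hq : q ∈ C) :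
    inner ℝ (u - p) (q - p) ≤ 0 := by
  have : Nonempty C := ⟨⟨p, h.1⟩⟩
  refine (norm_eq_iInf_iff_real_inner_le_zero hC h.1).1 ?_ q hq
  refine le_antisymm (le_ciInf fun w => ?_) (ciInf_le ⟨0, ?_⟩ (⟨p, h.1⟩ : C))
  · simpa [dist_eq_norm] using h.2 w w.2
  · rintro _ ⟨w, rfl⟩
    exact norm_nonneg _

lemma exists_isProj [CompleteSpace E] (hne : C.Nonempty) (hcl : IsClosed C) (hC : Convex ℝ C)
    (u : E) : ∃ p, IsProj C u p := by
  obtain ⟨p, hp, hmin⟩ := exists_norm_eq_iInf_of_complete_convex hne hcl.isComplete hC u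
  refine ⟨p, hp, fun q hq => ?_⟩
  rw [dist_eq_norm, dist_eq_norm, hmin]
  exact ciInf_le (f := fun w : C => ‖u - w‖) ⟨0, by rintro _ ⟨w, rfl⟩; exact norm_nonneg _⟩ ⟨q, hq⟩

lemma IsProj.norm_sub_le (h : IsProj C u p) (h' : IsProj C u' p') (hC : Convex ℝ C) :
    ‖p - p'‖ ≤ ‖u - u'‖ := by
  have h1 := h.inner_le_zero hC h'.1
  have h2 := h'.inner_le_zero hC h.1
  -- Firm nonexpansiveness, the sum of the two obtuse-angle inequalities; Cauchy-Schwarz then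
  -- finishes.
  have h3 : ‖p - p'‖ ^ 2 ≤ inner ℝ (u - u') (p - p') := by
    have e : inner ℝ (u - u') (p - p') =
        ‖p - p'‖ ^ 2 - inner ℝ (u - p) (p' - p) - inner ℝ (u' - p') (p - p') := by
      rw [← real_inner_self_eq_norm_sq]
      simp only [inner_sub_left, inner_sub_right]
      ring
    linarith
  have h4 := real_inner_le_norm (u - u') (p - p')
  by_contra hlt
  push Not at hlt
  nlinarith [norm_nonneg (p - p'), norm_nonneg (u - u')]

lemma IsProj.norm_sub_sq_le (h : IsProj C u p) (hC : Convex ℝ C) (hq : q ∈ C) :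
    ‖p - q‖ ^ 2 ≤ ‖u - q‖ ^ 2 - ‖u - p‖ ^ 2 := by
  have h1 := h.inner_le_zero hC hq
  have e : ‖u - q‖ ^ 2 = ‖u - p‖ ^ 2 + ‖p - q‖ ^ 2 - 2 * inner ℝ (u - p) (q - p) := by
    simp only [← real_inner_self_eq_norm_sq, inner_sub_left, inner_sub_right]
    rw [real_inner_comm u p, real_inner_comm u q, real_inner_comm p q]
    ring
  linarith


lemma IsProj.norm_sub_le_of_mem (h : IsProj C u p) (hC : Convex ℝ C) (hq : q ∈ C) :
    ‖p - q‖ ≤ ‖u - q‖ := h.norm_sub_le ⟨hq, fun r _ => by simp⟩ hC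

lemma IsProj.infDist_eq (h : IsProj C u p) : Metric.infDist u C = ‖u - p‖ := by
  rw [← dist_eq_norm]
  exact le_antisymm (Metric.infDist_le_dist_of_mem h.1)
    ((Metric.le_infDist ⟨p, h.1⟩).2 fun {y} hy => h.2 y hy)

/-- The projection of a measurable function onto a closed convex set is measurable. -/
lemma measurable_of_isProj [CompleteSpace E] [MeasurableSpace E] [BorelSpace E]
    {Ω : Type*} [MeasurableSpace Ω] {f r : Ω → E} (hcl : IsClosed C) (hC : Convex ℝ C)
    (hf : Measurable f) (hr : ∀ ω, IsProj C (f ω) (r ω)) : Measurable r := by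
  rcases isEmpty_or_nonempty Ω with hΩ | ⟨⟨ω₀⟩⟩
  · exact measurable_of_empty r
  -- By uniqueness of projections, `r` must be the composition of `f` with the 1-Lipschitz map `π`.
  choose π hπ using exists_isProj ⟨_, (hr ω₀).1⟩ hcl hC
  have hc : LipschitzWith 1 π := LipschitzWith.of_dist_le_mul fun a b => by
    simpa [dist_eq_norm] using (hπ a).norm_sub_le (hπ b) hC
  have : r = π ∘ f := by
    funext ω
    have := (hr ω).norm_sub_le (hπ (f ω)) hC
    simpa [sub_eq_zero] using this
  rw [this]
  exact hc.continuous.measurable.comp hf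

end Projection

/-! ### Positive parts of extended-real-valued convex functions -/

section PlusPart

variable {E : Type*} [NormedAddCommGroup E] [InnerProductSpace ℝ E] {f : E → EReal} {x z d : E}

lemma IsConvexFun.convex_sublevel (h : IsConvexFun f) : Convex ℝ {x | f x ≤ 0} := by
  intro x hx y hy a b ha hb hab
  have h1 : (x, (0 : ℝ)) ∈ {p : E × ℝ | f p.1 ≤ (p.2 : EReal)} := by simpa using hx
  have h2 : (y, (0 : ℝ)) ∈ {p : E × ℝ | f p.1 ≤ (p.2 : EReal)} := by simpa using hy
  simpa using h.2 h1 h2 ha hb hab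

lemma plusPart_nonneg : 0 ≤ plusPart f x := le_max_right _ _

lemma plusPart_toReal_nonneg : 0 ≤ (plusPart f x).toReal := EReal.toReal_nonneg plusPart_nonneg

lemma plusPart_eq_zero (h : f x ≤ 0) : plusPart f x = 0 := max_eq_right h

lemma plusPart_toReal_eq_zero (h : f x ≤ 0) : (plusPart f x).toReal = 0 := by
  rw [plusPart_eq_zero h, EReal.toReal_zero]

lemma plusPart_ne_bot : plusPart f x ≠ ⊥ :=
  ne_of_gt (lt_of_lt_of_le EReal.bot_lt_zero plusPart_nonneg)

lemma subdiff_toReal_le (hd : d ∈ subdiff (plusPart f) x) (hz : plusPart f z ≠ ⊤) :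
    (plusPart f x).toReal + inner ℝ d (z - x) ≤ (plusPart f z).toReal := by
  have h := hd.2.2 z
  rw [← EReal.coe_toReal hd.1 hd.2.1, ← EReal.coe_toReal hz plusPart_ne_bot] at h
  exact_mod_cast h

/-- The positive part is Lipschitz on a set where its subgradients exist and are bounded. -/
lemma plusPart_toReal_le_add {S : Set E} {C : ℝ}
    (hne : ∀ x ∈ S, (subdiff (plusPart f) x).Nonempty)
    (hC : ∀ x ∈ S, ∀ d ∈ subdiff (plusPart f) x, ‖d‖ ≤ C) (hx : x ∈ S) (hz : z ∈ S) :
    (plusPart f x).toReal ≤ (plusPart f z).toReal + C * ‖x - z‖ := by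
  obtain ⟨d, hd⟩ := hne x hx
  obtain ⟨e, he⟩ := hne z hz
  have h1 := subdiff_toReal_le hd he.1
  have h2 : -(inner ℝ d (z - x)) ≤ C * ‖x - z‖ := by
    rw [← inner_neg_right, neg_sub]
    exact (real_inner_le_norm _ _).trans
      (mul_le_mul_of_nonneg_right (hC x hx d hd) (norm_nonneg _))
  linarith

end PlusPart

/-! ### Almost supermartingales -/

section AlmostSupermartingale

variable {Ω : Type*} {m0 : MeasurableSpace Ω} {P : Measure Ω} [IsProbabilityMeasure P]

/-- A nonnegative real sequence with `u (k+1) ≤ (1 - a k) u k + b k`, `∑ a = ∞`, `∑ b < ∞`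
gets arbitrarily small. -/
lemma frequently_lt_of_recursion {u a b : ℕ → ℝ} (hu : ∀ k, 0 ≤ u k) (ha : ∀ k, 0 ≤ a k)
    (hb : ∀ k, 0 ≤ b k) (hbs : Summable b)
    (has : Tendsto (fun N => ∑ k ∈ Finset.range N, a k) atTop atTop)
    (hrec : ∀ k, u (k + 1) ≤ (1 - a k) * u k + b k) {δ : ℝ} (hδ : 0 < δ) :
    ∃ᶠ k in atTop, u k < δ := by
  intro hev
  simp only [not_lt] at hev
  obtain ⟨K, hK⟩ := eventually_atTop.1 hev
  have key : ∀ N, u N + ∑ k ∈ Finset.range N, a k * u k ≤ u 0 + ∑ k ∈ Finset.range N, b k := by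
    intro N
    induction N with
    | zero => simp
    | succ N ih =>
      rw [Finset.sum_range_succ, Finset.sum_range_succ]
      linarith [hrec N]
  -- From index `K` on each summand is at least `δ * a k`; subtracting the first `K` terms makes the
  -- bound valid for every `N`.
  have hlow : ∀ N, δ * (∑ k ∈ Finset.range N, a k - ∑ k ∈ Finset.range K, a k) ≤
      ∑ k ∈ Finset.range N, a k * u k := by
    intro N
    induction N with
    | zero =>
      have : 0 ≤ ∑ k ∈ Finset.range K, a k := Finset.sum_nonneg fun i _ => ha i
      simp only [Finset.range_zero, Finset.sum_empty]
      nlinarith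
    | succ N ih =>
      by_cases hN : K ≤ N
      · rw [Finset.sum_range_succ, Finset.sum_range_succ]
        nlinarith [hK N hN, ha N]
      · have h1 : ∑ k ∈ Finset.range (N + 1), a k ≤ ∑ k ∈ Finset.range K, a k :=
          Finset.sum_le_sum_of_subset_of_nonneg
            (Finset.range_subset_range.2 (by omega)) fun i _ _ => ha i
        have h2 : 0 ≤ ∑ k ∈ Finset.range (N + 1), a k * u k :=
          Finset.sum_nonneg fun i _ => mul_nonneg (ha i) (hu i)
        nlinarith
  obtain ⟨N, hN⟩ := (has.eventually_gt_atTop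
    ((u 0 + ∑' k, b k) / δ + ∑ k ∈ Finset.range K, a k)).exists
  have h1 := key N
  have h2 := hlow N
  have h3 := hbs.sum_le_tsum (Finset.range N) fun i _ => hb i
  have h4 : (u 0 + ∑' k, b k) / δ < ∑ k ∈ Finset.range N, a k - ∑ k ∈ Finset.range K, a k := by
    linarith
  rw [div_lt_iff₀ hδ] at h4
  linarith [hu N]

/-- A nonnegative adapted sequence with `𝔼[U (k+1) | 𝓖 k] ≤ (1 - a k) U k + b k`, `∑ a = ∞`,
`∑ b < ∞` tends to `0` almost surely. -/
theorem ae_tendsto_zero_of_almost_supermartingale (𝒢 : Filtration ℕ m0) {U : ℕ → Ω → ℝ}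
    {a b : ℕ → ℝ} (hU : ∀ k ω, 0 ≤ U k ω) (hadp : ∀ k, Measurable[𝒢 k] (U k))
    (hint : ∀ k, Integrable (U k) P) (ha : ∀ k, 0 ≤ a k) (hb : ∀ k, 0 ≤ b k) (hbs : Summable b)
    (has : Tendsto (fun N => ∑ k ∈ Finset.range N, a k) atTop atTop)
    (hrec : ∀ k A, MeasurableSet[𝒢 k] A →
      ∫ ω in A, U (k + 1) ω ∂P ≤ ∫ ω in A, ((1 - a k) * U k ω + b k) ∂P) :
    ∀ᵐ ω ∂P, Tendsto (fun k => U k ω) atTop (𝓝 0) := by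
  set S : ℕ → ℝ := fun k => ∑ i ∈ Finset.range k, b i with hS
  have hS0 : ∀ k, 0 ≤ S k := fun k => Finset.sum_nonneg fun i _ => hb i
  have hST : ∀ k, S k ≤ ∑' i, b i := fun k => hbs.sum_le_tsum _ fun i _ => hb i
  -- Adding back the accumulated perturbations turns the recursion into a submartingale bounded in
  -- `L¹`, so `U` has an almost sure limit.
  have hsub : Submartingale (fun k ω => S k - U k ω) 𝒢 P := by
    refine submartingale_of_setIntegral_le_succ ?_ ?_ ?_
    · intro k
      exact ((hadp k).const_sub (S k)).stronglyMeasurable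
    · exact fun k => (integrable_const _).sub (hint k)
    · intro k A hA
      have hi : Integrable (fun ω => (1 - a k) * U k ω + b k) P :=
        ((hint k).const_mul _).add (integrable_const _)
      refine (?_ : _ ≤ ∫ ω in A, (S k - ((1 - a k) * U k ω + b k) + b k) ∂P).trans ?_
      · refine setIntegral_mono ((integrable_const _).sub (hint k)).integrableOn ?_ fun ω => ?_
        · exact (((integrable_const _).sub hi).add (integrable_const _)).integrableOn
        · nlinarith [hU k ω, ha k]
      · have e1 : ∫ ω in A, (S k - ((1 - a k) * U k ω + b k) + b k) ∂P =
            ∫ ω in A, (S (k + 1)) ∂P - ∫ ω in A, ((1 - a k) * U k ω + b k) ∂P := by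
          rw [← integral_sub (integrable_const _) hi.integrableOn]
          refine integral_congr_ae (ae_of_all _ fun ω => ?_)
          simp only [hS, Finset.sum_range_succ]
          ring
        rw [e1, integral_sub (integrable_const _) (hint (k + 1)).integrableOn]
        linarith [hrec k A hA]
  have hmean : ∀ k, ∫ ω, U (k + 1) ω ∂P ≤ (1 - a k) * ∫ ω, U k ω ∂P + b k := by
    intro k
    have := hrec k Set.univ MeasurableSet.univ
    rwa [setIntegral_univ, setIntegral_univ, integral_add ((hint k).const_mul _)
      (integrable_const _), integral_const_mul, integral_const, probReal_univ, one_smul] at this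
  have hmean0 : ∀ k, 0 ≤ ∫ ω, U k ω ∂P := fun k => integral_nonneg (hU k)
  have hbd : ∀ k, ∫ ω, U k ω ∂P ≤ ∫ ω, U 0 ω ∂P + S k := by
    intro k
    induction k with
    | zero => simp [hS]
    | succ k ih =>
      have h1 := hmean k
      have h2 : S (k + 1) = S k + b k := Finset.sum_range_succ _ _
      nlinarith [ha k, hmean0 k]
  set R : ℝ := 2 * ∑' i, b i + ∫ ω, U 0 ω ∂P with hR
  have hconv := hsub.exists_ae_tendsto_of_bdd (R := R.toNNReal) fun k => by
    have hj : Integrable (fun ω => S k - U k ω) P := (integrable_const _).sub (hint k)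
    rw [eLpNorm_one_eq_lintegral_enorm, ← ofReal_integral_norm_eq_lintegral_enorm hj]
    refine ENNReal.ofReal_le_ofReal ?_
    calc ∫ ω, ‖S k - U k ω‖ ∂P ≤ ∫ ω, (S k + U k ω) ∂P := by
          refine integral_mono hj.norm
            ((integrable_const _).add (hint k)) fun ω => ?_
          rw [Real.norm_eq_abs]
          exact abs_le.2 ⟨by linarith [hS0 k], by linarith [hU k ω]⟩
      _ = S k + ∫ ω, U k ω ∂P := by
          rw [integral_add (integrable_const _) (hint k)]; simp
      _ ≤ R := by linarith [hbd k, hST k]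
  have hSt : Tendsto S atTop (𝓝 (∑' i, b i)) := hbs.hasSum.tendsto_sum_nat
  have hmeas : ∀ k, Measurable (U k) := fun k => (hadp k).mono (𝒢.le k) le_rfl
  -- The limit is identified by Fatou: the means of `U` become arbitrarily small infinitely often,
  -- so the pointwise liminf vanishes almost everywhere.
  have hfat : ∫⁻ ω, liminf (fun k => ENNReal.ofReal (U k ω)) atTop ∂P = 0 := by
    refine le_antisymm ((lintegral_liminf_le fun k => (hmeas k).ennreal_ofReal).trans ?_) bot_le
    refine le_of_forall_pos_le_add fun δ hδ => ?_
    rw [zero_add]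
    rcases eq_or_ne δ ⊤ with rfl | hδt
    · exact le_top
    refine liminf_le_of_frequently_le' ?_
    refine (frequently_lt_of_recursion hmean0 ha hb hbs has hmean
      (ENNReal.toReal_pos hδ.ne' hδt)).mono fun k hk => ?_
    rw [← ofReal_integral_eq_lintegral_ofReal (hint k) (ae_of_all _ (hU k))]
    exact ENNReal.ofReal_le_of_le_toReal hk.le
  rw [lintegral_eq_zero_iff (Measurable.liminf fun k => (hmeas k).ennreal_ofReal)] at hfat
  filter_upwards [hconv, hfat] with ω ⟨l, h1⟩ h2
  have h3 : Tendsto (fun k => U k ω) atTop (𝓝 (∑' i, b i - l)) :=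
    (hSt.sub h1).congr fun k => by ring
  have h4 := ((ENNReal.continuous_ofReal.tendsto _).comp h3).liminf_eq
  simp only [Function.comp_def] at h4
  rw [h4] at h2
  have h5 := ge_of_tendsto' h3 fun k => hU k ω
  have h6 := ENNReal.ofReal_eq_zero.1 h2
  rwa [le_antisymm h6 h5] at h3

end AlmostSupermartingale

/-! ### Monotone variational inequalities -/

section Monotone

variable {E : Type*} [NormedAddCommGroup E] [InnerProductSpace ℝ E] {T : E → E} {X : Set E}

/-- A strongly monotone Lipschitz variational inequality on a closed convex set is solvable. -/
lemma solSet_nonempty_of_strongly_monotone [CompleteSpace E] (hne : X.Nonempty)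
    (hcl : IsClosed X) (hX : Convex ℝ X) {μ K : ℝ} (hμ : 0 < μ)
    (hK : ∀ x y, ‖T y - T x‖ ≤ K * ‖y - x‖)
    (hmono : ∀ x y, μ * ‖y - x‖ ^ 2 ≤ inner ℝ (T y - T x) (y - x)) :
    (solSet T X).Nonempty := by
  choose π hπ using exists_isProj hne hcl hX
  -- Enlarging the Lipschitz constant gives `0 < L` and `μ ≤ L`, so the square root below has a
  -- nonnegative argument.
  set L : ℝ := max K μ with hL
  have hLpos : 0 < L := lt_of_lt_of_le hμ (le_max_right _ _)
  have hLK : ∀ x y, ‖T y - T x‖ ≤ L * ‖y - x‖ := fun x y =>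
    (hK x y).trans (mul_le_mul_of_nonneg_right (le_max_left _ _) (norm_nonneg _))
  -- This step minimizes `1 - 2τμ + τ²L²`, the squared Lipschitz factor of the projected step; the
  -- minimum is `1 - μ²/L²`.
  set τ : ℝ := μ / L ^ 2 with hτ
  have hτpos : 0 < τ := by positivity
  set q : ℝ := Real.sqrt (1 - μ ^ 2 / L ^ 2) with hq
  have hq1 : 0 ≤ 1 - μ ^ 2 / L ^ 2 := by
    rw [sub_nonneg, div_le_one (by positivity)]
    exact pow_le_pow_left₀ hμ.le (le_max_right _ _) 2
  have hqlt : q < 1 := by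
    rw [hq, Real.sqrt_lt' one_pos]
    have : 0 < μ ^ 2 / L ^ 2 := by positivity
    linarith
  have hcontr : ContractingWith q.toNNReal (fun x => π (x - τ • T x)) := by
    refine ⟨by rw [← NNReal.coe_lt_coe, Real.coe_toNNReal _ (Real.sqrt_nonneg _)]; simpa,
      LipschitzWith.of_dist_le_mul fun x y => ?_⟩
    rw [Real.coe_toNNReal _ (Real.sqrt_nonneg _), dist_eq_norm, dist_eq_norm]
    refine ((hπ _).norm_sub_le (hπ _) hX).trans ?_
    refine le_of_sq_le_sq ?_ (mul_nonneg (Real.sqrt_nonneg _) (norm_nonneg _))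
    rw [mul_pow, Real.sq_sqrt hq1]
    have e : x - τ • T x - (y - τ • T y) = (x - y) - τ • (T x - T y) := by
      rw [smul_sub]; abel
    rw [e, norm_sub_sq_real, norm_smul, Real.norm_eq_abs, abs_of_pos hτpos, inner_smul_right,
      real_inner_comm]
    have h1 := hmono y x
    have h2 : (τ * ‖T x - T y‖) ^ 2 ≤ τ ^ 2 * (L ^ 2 * ‖x - y‖ ^ 2) := by
      rw [mul_pow, ← mul_pow L]
      exact mul_le_mul_of_nonneg_left (pow_le_pow_left₀ (norm_nonneg _) (hLK y x) 2) (sq_nonneg _)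
    have h3 : τ ^ 2 * (L ^ 2 * ‖x - y‖ ^ 2) = τ * μ * ‖x - y‖ ^ 2 := by
      rw [hτ]; field_simp
    have h4 : μ ^ 2 / L ^ 2 = τ * μ := by rw [hτ]; field_simp
    rw [h4]
    nlinarith [mul_le_mul_of_nonneg_left h1 hτpos.le]
  obtain ⟨z, hz, -⟩ := hcontr.exists_fixedPoint 0 (edist_ne_top _ _)
  have hz' : π (z - τ • T z) = z := hz
  have hp := hπ (z - τ • T z)
  rw [hz'] at hp
  refine ⟨z, hp.1, fun y hy => ?_⟩
  have := hp.inner_le_zero hX hy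
  rw [sub_sub_cancel_left, inner_neg_left, inner_smul_left] at this
  simp only [conj_trivial] at this
  nlinarith

/-- Minty's reformulation: with `T` evaluated at the test point, the condition is affine in the
unknown, so convexity of the solution set becomes visible. -/
lemma solSet_eq_minty (hX : Convex ℝ X) (hT : Continuous T)
    (hmono : ∀ x y, 0 ≤ inner ℝ (T y - T x) (y - x)) :
    solSet T X = {x | x ∈ X ∧ ∀ y ∈ X, 0 ≤ inner ℝ (T y) (y - x)} := by
  ext x
  refine and_congr_right fun hx => ⟨fun h y hy => ?_, fun h y hy => ?_⟩
  · have h1 := h y hy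
    have h2 := hmono x y
    rw [inner_sub_left] at h2
    linarith
  -- Test with `x + s (y - x)`, divide by `s`, and let `s` decrease to `0`.
  · have hlim : Tendsto (fun s : ℝ => inner ℝ (T (x + s • (y - x))) (y - x)) (𝓝[>] 0)
        (𝓝 (inner ℝ (T x) (y - x))) := by
      have hc : Continuous fun s : ℝ => inner ℝ (T (x + s • (y - x))) (y - x) := by fun_prop
      have := hc.tendsto 0
      simp only [zero_smul, add_zero] at this
      exact this.mono_left nhdsWithin_le_nhds
    refine ge_of_tendsto hlim ?_
    filter_upwards [Ioo_mem_nhdsGT (zero_lt_one' ℝ)] with s hs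
    have h1 := h _ (hX.add_smul_sub_mem hx hy ⟨hs.1.le, hs.2.le⟩)
    rw [add_sub_cancel_left, inner_smul_right] at h1
    exact nonneg_of_mul_nonneg_right h1 hs.1

lemma convex_solSet (hX : Convex ℝ X) (hT : Continuous T)
    (hmono : ∀ x y, 0 ≤ inner ℝ (T y - T x) (y - x)) : Convex ℝ (solSet T X) := by
  rw [solSet_eq_minty hX hT hmono]
  intro x hx x' hx' a b ha hb hab
  refine ⟨hX hx.1 hx'.1 ha hb hab, fun y hy => ?_⟩
  have e : y - (a • x + b • x') = a • (y - x) + b • (y - x') := by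
    rw [smul_sub, smul_sub]
    nth_rewrite 1 [← one_smul ℝ y]
    rw [← hab, add_smul]; abel
  rw [e, inner_add_right, inner_smul_right, inner_smul_right]
  exact add_nonneg (mul_nonneg ha (hx.2 y hy)) (mul_nonneg hb (hx'.2 y hy))

lemma isClosed_solSet (hcl : IsClosed X) (hT : Continuous T) : IsClosed (solSet T X) := by
  have : solSet T X = X ∩ ⋂ y ∈ X, {x | 0 ≤ inner ℝ (T x) (y - x)} := by
    ext x; simp [solSet]
  rw [this]
  exact hcl.inter (isClosed_biInter fun y _ => isClosed_le continuous_const (by fun_prop))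

lemma isLeastNorm_iff_isProj {S : Set E} {z : E} : IsLeastNorm S z ↔ IsProj S 0 z := by
  simp [IsLeastNorm, IsProj]

lemma existsUnique_isLeastNorm [CompleteSpace E] {S : Set E} (hne : S.Nonempty)
    (hcl : IsClosed S) (hS : Convex ℝ S) : ∃! z, IsLeastNorm S z := by
  simp only [isLeastNorm_iff_isProj]
  obtain ⟨z, hz⟩ := exists_isProj hne hcl hS 0
  refine ⟨z, hz, fun z' hz' => ?_⟩
  simpa [sub_eq_zero] using hz'.norm_sub_le hz hS

end Monotone

/-! ### Diagonal operators on the product space -/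

section Scale

variable {m : ℕ} {n : Fin m → ℕ}

/-- The block-diagonal operator `x ↦ (c_1 x_1, …, c_m x_m)`. -/
def scale (c : Fin m → ℝ) (x : Prd n) : Prd n := WithLp.toLp 2 (fun j => c j • x j)

@[simp] lemma scale_apply (c : Fin m → ℝ) (x : Prd n) (j : Fin m) : scale c x j = c j • x j := rfl

lemma scale_sub (c : Fin m → ℝ) (x y : Prd n) : scale c (x - y) = scale c x - scale c y := by
  ext j : 1
  simp [smul_sub]

lemma scale_sub_left (c c' : Fin m → ℝ) (x : Prd n) :
    scale (c - c') x = scale c x - scale c' x := by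
  ext j : 1
  simp [sub_smul]

lemma inner_scale_left (c : Fin m → ℝ) (x y : Prd n) :
    inner ℝ (scale c x) y = ∑ j, c j * inner ℝ (x j) (y j) := by
  simp [PiLp.inner_apply, inner_smul_left]

lemma inner_scale_comm (c : Fin m → ℝ) (x y : Prd n) :
    inner ℝ (scale c x) y = inner ℝ x (scale c y) := by
  simp [PiLp.inner_apply, inner_smul_left, inner_smul_right]

lemma mul_norm_sq_le_inner_scale {c : Fin m → ℝ} {e : ℝ} (hc : ∀ j, e ≤ c j) (x : Prd n) :
    e * ‖x‖ ^ 2 ≤ inner ℝ (scale c x) x := by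
  rw [inner_scale_left, PiLp.norm_sq_eq_of_L2, Finset.mul_sum]
  refine Finset.sum_le_sum fun j _ => ?_
  rw [real_inner_self_eq_norm_sq]
  exact mul_le_mul_of_nonneg_right (hc j) (sq_nonneg _)

lemma norm_scale_le {c : Fin m → ℝ} {K : ℝ} (hK : 0 ≤ K) (hc : ∀ j, |c j| ≤ K) (x : Prd n) :
    ‖scale c x‖ ≤ K * ‖x‖ := by
  refine le_of_sq_le_sq ?_ (mul_nonneg hK (norm_nonneg _))
  rw [mul_pow, PiLp.norm_sq_eq_of_L2, PiLp.norm_sq_eq_of_L2, Finset.mul_sum]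
  refine Finset.sum_le_sum fun j _ => ?_
  rw [scale_apply, norm_smul, mul_pow, Real.norm_eq_abs]
  exact mul_le_mul_of_nonneg_right (pow_le_pow_left₀ (abs_nonneg _) (hc j) 2) (sq_nonneg _)

@[fun_prop] lemma continuous_scale (c : Fin m → ℝ) : Continuous (scale c : Prd n → Prd n) :=
  (PiLp.continuous_toLp 2 _).comp (by fun_prop)

variable [NeZero m]

lemma rowMin_le (u : Fin m → ℝ) (j : Fin m) : rowMin u ≤ u j :=
  ciInf_le (Set.finite_range u).bddBelow j

lemma le_rowMax (u : Fin m → ℝ) (j : Fin m) : u j ≤ rowMax u :=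
  le_ciSup (Set.finite_range u).bddAbove j

lemma exists_eq_rowMin (u : Fin m → ℝ) : ∃ j, u j = rowMin u := by
  simpa [rowMin] using exists_eq_ciInf_of_finite (f := u)

lemma exists_eq_rowMax (u : Fin m → ℝ) : ∃ j, u j = rowMax u := by
  simpa [rowMax] using exists_eq_ciSup_of_finite (f := u)

lemma rowMin_le_rowMax (u : Fin m → ℝ) : rowMin u ≤ rowMax u :=
  (rowMin_le u 0).trans (le_rowMax u 0)

end Scale

/-! ### Tikhonov regularization -/

section Tikhonov

variable {m : ℕ} {n : Fin m → ℕ} {T : Prd n → Prd n} {X : Set (Prd n)}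

/-- The regularized operator `T + diag(c)`. -/
def regOp (T : Prd n → Prd n) (c : Fin m → ℝ) (x : Prd n) : Prd n := T x + scale c x

lemma regOp_strongly_monotone (hmono : ∀ x y, 0 ≤ inner ℝ (T y - T x) (y - x))
    {c : Fin m → ℝ} {e : ℝ} (hc : ∀ j, e ≤ c j) (x y : Prd n) :
    e * ‖y - x‖ ^ 2 ≤ inner ℝ (regOp T c y - regOp T c x) (y - x) := by
  have h : regOp T c y - regOp T c x = (T y - T x) + scale c (y - x) := by
    rw [scale_sub, regOp, regOp]; abel
  rw [h, inner_add_left]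
  linarith [hmono x y, mul_norm_sq_le_inner_scale hc (y - x)]

lemma regOp_lipschitz {K E : ℝ} (hK : ∀ x y, ‖T y - T x‖ ≤ K * ‖y - x‖) (hE : 0 ≤ E)
    {c : Fin m → ℝ} (hc : ∀ j, |c j| ≤ E) (x y : Prd n) :
    ‖regOp T c y - regOp T c x‖ ≤ (K + E) * ‖y - x‖ := by
  have h : regOp T c y - regOp T c x = (T y - T x) + scale c (y - x) := by
    rw [scale_sub, regOp, regOp]; abel
  rw [h, add_mul]
  exact (norm_add_le _ _).trans (add_le_add (hK x y) (norm_scale_le hE hc _))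

/-- Testing each solution in the other's inequality and using monotonicity gives `⟨c t, x - t⟩ ≥ 0`.
Expanding `⟨c (x - t), x - t⟩ ≥ 0` then yields `⟨c t, t⟩ ≤ ⟨c x, x⟩`. The ratio `E / e` is the price
of returning to the unweighted norm. -/
lemma norm_sq_le_of_mem_solSet_regOp (hmono : ∀ x y, 0 ≤ inner ℝ (T y - T x) (y - x))
    {c : Fin m → ℝ} {e E : ℝ} (hc0 : ∀ j, 0 ≤ c j) (hc : ∀ j, e ≤ c j) (hc' : ∀ j, c j ≤ E)
    {t x : Prd n} (ht : t ∈ solSet (regOp T c) X) (hx : x ∈ solSet T X) :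
    e * ‖t‖ ^ 2 ≤ E * ‖x‖ ^ 2 := by
  have h1 := ht.2 x hx.1
  have h2 := hx.2 t ht.1
  have h3 := hmono x t
  rw [regOp, inner_add_left] at h1
  have h4 : inner ℝ (T t) (x - t) = - inner ℝ (T t) (t - x) := by rw [← inner_neg_right, neg_sub]
  rw [inner_sub_left] at h3
  have h5 : 0 ≤ inner ℝ (scale c t) (x - t) := by linarith
  have h6 := mul_norm_sq_le_inner_scale hc t
  have h7 : inner ℝ (scale c x) x ≤ E * ‖x‖ ^ 2 := by
    rw [inner_scale_left, PiLp.norm_sq_eq_of_L2, Finset.mul_sum]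
    refine Finset.sum_le_sum fun j _ => ?_
    rw [real_inner_self_eq_norm_sq]
    exact mul_le_mul_of_nonneg_right (hc' j) (sq_nonneg _)
  have h8 : 0 ≤ inner ℝ (scale c (x - t)) (x - t) := by
    simpa using mul_norm_sq_le_inner_scale (e := 0) hc0 (x - t)
  have h9 : inner ℝ (scale c (x - t)) (x - t) = inner ℝ (scale c x) x - inner ℝ (scale c t) t
      - 2 * inner ℝ (scale c t) (x - t) := by
    rw [scale_sub]
    simp only [inner_sub_left, inner_sub_right]
    rw [inner_scale_comm c x t, real_inner_comm (scale c t) x]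
    ring
  linarith

/-- Cross-testing the two inequalities eliminates `T` by monotonicity; only the difference of the
regularizers, applied to `t'`, drives the displacement. This controls the speed of the Tikhonov
trajectory. -/
lemma mul_norm_sub_le_of_mem_solSet_regOp (hmono : ∀ x y, 0 ≤ inner ℝ (T y - T x) (y - x))
    {c c' : Fin m → ℝ} {e G : ℝ} (hc : ∀ j, e ≤ c j) (hG : 0 ≤ G) (hcc : ∀ j, |c' j - c j| ≤ G)
    {t t' : Prd n} (ht : t ∈ solSet (regOp T c) X) (ht' : t' ∈ solSet (regOp T c') X) :
    e * ‖t - t'‖ ≤ G * ‖t'‖ := by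
  have h1 := ht.2 t' ht'.1
  have h2 := ht'.2 t ht.1
  have h3 := hmono t' t
  have h4 := mul_norm_sq_le_inner_scale hc (t - t')
  have h5 : inner ℝ (scale c (t - t')) (t - t') ≤ inner ℝ (scale (c' - c) t') (t - t') := by
    rw [scale_sub, scale_sub_left]
    simp only [regOp, inner_add_left] at h1 h2
    simp only [inner_sub_left, inner_sub_right] at h1 h2 h3 ⊢
    linarith
  have h6 := real_inner_le_norm (scale (c' - c) t') (t - t')
  have h7 := norm_scale_le (c := c' - c) hG hcc t'
  rcases (norm_nonneg (t - t')).eq_or_lt with h0 | h0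
  · rw [← h0, mul_zero]
    exact mul_nonneg hG (norm_nonneg _)
  · refine le_of_mul_le_mul_right ?_ h0
    nlinarith

/-- Along a convergent subsequence the regularization term vanishes, and the inequality passes to
the limit by continuity. -/
lemma mem_solSet_of_mapClusterPt (hcl : IsClosed X) (hT : Continuous T) {c : ℕ → Fin m → ℝ}
    (hc : ∀ j, Tendsto (fun k => c k j) atTop (𝓝 0)) {t : ℕ → Prd n}
    (ht : ∀ k, t k ∈ solSet (regOp T (c k)) X) {z : Prd n} (hz : MapClusterPt z atTop t) :
    z ∈ solSet T X := by
  obtain ⟨φ, hφ, hlim⟩ := hz.tendsto_subseq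
  have hs : Tendsto (fun k => scale (c (φ k)) (t (φ k))) atTop (𝓝 0) := by
    refine ((PiLp.continuous_toLp 2 _).tendsto (0 : ∀ j, Block n j)).comp (tendsto_pi_nhds.2 ?_)
    intro j
    have h1 : Tendsto (fun k => (t (φ k)) j) atTop (𝓝 (z j)) :=
      ((PiLp.continuous_apply 2 _ j).tendsto z).comp hlim
    simpa using ((hc j).comp hφ.tendsto_atTop).smul h1
  have hR : Tendsto (fun k => regOp T (c (φ k)) (t (φ k))) atTop (𝓝 (T z)) := by
    simpa [regOp, Function.comp_def] using ((hT.tendsto z).comp hlim).add hs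
  refine ⟨hcl.mem_of_tendsto hlim (Eventually.of_forall fun k => (ht (φ k)).1), fun y hy => ?_⟩
  exact ge_of_tendsto' (hR.inner (tendsto_const_nhds.sub hlim)) fun k => (ht (φ k)).2 y hy

/-- If `limsup (max c_k / min c_k) ≤ 1`, the Tikhonov trajectory tends to the least-norm solution. -/
lemma tendsto_isLeastNorm_of_solSet_regOp [NeZero m] (hcl : IsClosed X) (hX : Convex ℝ X)
    (hT : Continuous T)
    (hmono : ∀ x y, 0 ≤ inner ℝ (T y - T x) (y - x)) {c : ℕ → Fin m → ℝ} (hpos : ∀ k j, 0 < c k j)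
    (hc : ∀ j, Tendsto (fun k => c k j) atTop (𝓝 0)) {t : ℕ → Prd n}
    (ht : ∀ k, t k ∈ solSet (regOp T (c k)) X) {M : ℝ} (hM : ∀ k, ‖t k‖ ≤ M)
    (hlim : ∀ q > (1 : ℝ), ∀ᶠ k in atTop, rowMax (c k) / rowMin (c k) < q)
    {z : Prd n} (hz : IsLeastNorm (solSet T X) z) : Tendsto t atTop (𝓝 z) := by
  refine (isCompact_closedBall (0 : Prd n) M).tendsto_nhds_of_unique_mapClusterPt
    (Eventually.of_forall fun k => by simpa using hM k) fun y _ hy => ?_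
  obtain ⟨φ, hφ, hlimφ⟩ := hy.tendsto_subseq
  have hyS := mem_solSet_of_mapClusterPt hcl hT hc ht hy
  have hS := convex_solSet hX hT hmono
  -- The weighted norm comparison loses at most a factor `q` in the limit; `q` is afterwards sent to
  -- `1`.
  have hbound : ∀ q > (1 : ℝ), ‖y‖ ^ 2 ≤ q * ‖z‖ ^ 2 := by
    intro q hq
    refine le_of_tendsto ((hlimφ.norm).pow 2) ?_
    filter_upwards [hφ.tendsto_atTop.eventually (hlim q hq)] with i hk
    set k := φ i
    obtain ⟨j, hj⟩ := exists_eq_rowMin (c k)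
    have hmin : 0 < rowMin (c k) := hj ▸ hpos k j
    rw [div_lt_iff₀ hmin] at hk
    have h1 := norm_sq_le_of_mem_solSet_regOp hmono (fun j => (hpos k j).le) (rowMin_le (c k))
      (le_rowMax (c k)) (ht k) hz.1
    have h2 : rowMax (c k) * ‖z‖ ^ 2 ≤ q * rowMin (c k) * ‖z‖ ^ 2 :=
      mul_le_mul_of_nonneg_right hk.le (sq_nonneg _)
    refine le_of_mul_le_mul_left (h1.trans (h2.trans (le_of_eq ?_))) hmin
    ring
  have hle : ‖y‖ ^ 2 ≤ ‖z‖ ^ 2 := by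
    have hlimit : Tendsto (fun q : ℝ => q * ‖z‖ ^ 2) (𝓝[>] 1) (𝓝 (1 * ‖z‖ ^ 2)) :=
      ((continuous_id.mul continuous_const).tendsto (1 : ℝ)).mono_left nhdsWithin_le_nhds
    rw [one_mul] at hlimit
    exact ge_of_tendsto hlimit (eventually_mem_nhdsWithin.mono fun q hq => hbound q hq)
  have hy' : IsLeastNorm (solSet T X) y :=
    ⟨hyS, fun w hw => (le_of_sq_le_sq hle (norm_nonneg _)).trans (hz.2 w hw)⟩
  exact (existsUnique_isLeastNorm ⟨z, hz.1⟩ (isClosed_solSet hcl hT) hS).unique hy' hz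

end Tikhonov

/-! ### One step of the method, for a single agent -/

section AgentStep

variable {E : Type*} [NormedAddCommGroup E] [InnerProductSpace ℝ E] {S : Set E}

lemma norm_sub_smul_sq (u v : E) (s : ℝ) :
    ‖u - s • v‖ ^ 2 = ‖u‖ ^ 2 - 2 * s * inner ℝ v u + s ^ 2 * ‖v‖ ^ 2 := by
  rw [norm_sub_sq_real, inner_smul_right, norm_smul, mul_pow, real_inner_comm, Real.norm_eq_abs,
    sq_abs]
  ring

/-- Young's inequality on `2a⟨G, x - y⟩` spends only half of the projection gain `‖x - y‖²`; the
other half is needed to compare the violations at `x` and `y`. -/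
lemma norm_sq_le_of_operator_step (hS : Convex ℝ S) {x y z G : E} {a : ℝ}
    (hy : IsProj S (x - a • G) y) (hz : z ∈ S) :
    ‖y - z‖ ^ 2 ≤ ‖x - z‖ ^ 2 - 1 / 2 * ‖x - y‖ ^ 2 - 2 * a * inner ℝ G (x - z)
      + 2 * a ^ 2 * ‖G‖ ^ 2 := by
  have h1 := hy.norm_sub_sq_le hS hz
  have e1 : x - a • G - z = (x - z) - a • G := by abel
  have e2 : x - a • G - y = (x - y) - a • G := by abel
  have h2 := sq_nonneg ‖(x - y) - (2 * a) • G‖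
  rw [e1, e2, norm_sub_smul_sq, norm_sub_smul_sq] at h1
  rw [norm_sub_smul_sq] at h2
  nlinarith

/-- A relaxed Polyak step: as `f z ≤ 0`, the subgradient inequality gives `f⁺ y ≤ ⟨d, y - z⟩`, so
the step gains `b (2 - b) (f⁺ y)² / ‖d‖²`. When `f y ≤ 0` the step length is zero, whatever `d` is.
-/
lemma norm_sq_le_of_feasibility_step (hS : Convex ℝ S) {f : E → EReal} {x' y z d : E} {b C : ℝ}
    (hb : 0 < b ∧ b < 2) (hC : 0 < C) (hz : z ∈ S) (hfz : f z ≤ 0) (hd : d ≠ 0)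
    (hsub : 0 < f y → d ∈ subdiff (plusPart f) y)
    (hbd : ∀ e ∈ subdiff (plusPart f) y, ‖e‖ ≤ C)
    (hx' : IsProj S (y - (b * (plusPart f y).toReal / ‖d‖ ^ 2) • d) x') :
    ‖x' - z‖ ^ 2 ≤ ‖y - z‖ ^ 2 - b * (2 - b) / C ^ 2 * (plusPart f y).toReal ^ 2 := by
  rcases le_or_gt (f y) 0 with hfy | hfy
  · rw [plusPart_toReal_eq_zero hfy] at hx' ⊢
    rw [mul_zero, zero_div, zero_smul, sub_zero] at hx'
    have := pow_le_pow_left₀ (norm_nonneg _) (hx'.norm_sub_le_of_mem hS hz) 2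
    simpa using this
  · set h := (plusPart f y).toReal with hh
    have hd' := hsub hfy
    have hz0 : plusPart f z = 0 := plusPart_eq_zero hfz
    have h1 := subdiff_toReal_le (z := z) hd' (by rw [hz0]; exact EReal.zero_ne_top)
    rw [hz0, EReal.toReal_zero, ← hh] at h1
    have hn : 0 < ‖d‖ := norm_pos_iff.2 hd
    have hnC : ‖d‖ ≤ C := hbd d hd'
    have h2 := pow_le_pow_left₀ (norm_nonneg _) (hx'.norm_sub_le_of_mem hS hz) 2
    set s := b * h / ‖d‖ ^ 2 with hs
    have h0 : 0 ≤ h := plusPart_toReal_nonneg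
    have hs0 : 0 ≤ s := by have := hb.1; positivity
    have e : y - s • d - z = (y - z) - s • d := by abel
    have e2 : inner ℝ d (y - z) = - inner ℝ d (z - y) := by rw [← inner_neg_right, neg_sub]
    rw [e, norm_sub_smul_sq] at h2
    have h3 : s ^ 2 * ‖d‖ ^ 2 = s * b * h := by rw [hs]; field_simp
    have h4 : s * h ≤ s * inner ℝ d (y - z) := mul_le_mul_of_nonneg_left (by linarith) hs0
    have h5 : b / C ^ 2 * h ≤ s := by
      rw [hs, div_mul_eq_mul_div]
      exact div_le_div_of_nonneg_left (mul_nonneg hb.1.le h0) (by positivity)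
        (pow_le_pow_left₀ hn.le hnC 2)
    have h6 : b / C ^ 2 * h * (h * (2 - b)) ≤ s * (h * (2 - b)) :=
      mul_le_mul_of_nonneg_right h5 (mul_nonneg h0 (by linarith [hb.2]))
    have h7 : b * (2 - b) / C ^ 2 * h ^ 2 = b / C ^ 2 * h * (h * (2 - b)) := by ring
    rw [h7]
    nlinarith

/-- The gain is moved from `y` to `x`, because `y` already involves the current operator sample
whereas regularity conditions on the past. Lipschitz continuity of `f⁺` makes the transfer cost a
multiple of `‖x - y‖²`, covered by the unspent half. -/
lemma norm_sq_le_of_steps (hS : Convex ℝ S) {f : E → EReal} {x x' y z d G : E} {a b B C : ℝ}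
    (hb : 0 < b ∧ b < 2) (hB0 : 0 ≤ B) (hB : B ≤ b * (2 - b)) (hC : 0 < C) (hx : x ∈ S)
    (hz : z ∈ S) (hfz : f z ≤ 0) (hd : d ≠ 0)
    (hsub : 0 < f y → d ∈ subdiff (plusPart f) y)
    (hne : ∀ x ∈ S, (subdiff (plusPart f) x).Nonempty)
    (hbd : ∀ x ∈ S, ∀ e ∈ subdiff (plusPart f) x, ‖e‖ ≤ C)
    (hy : IsProj S (x - a • G) y)
    (hx' : IsProj S (y - (b * (plusPart f y).toReal / ‖d‖ ^ 2) • d) x') :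
    ‖x' - z‖ ^ 2 ≤ ‖x - z‖ ^ 2 - 2 * a * inner ℝ G (x - z) + 2 * a ^ 2 * ‖G‖ ^ 2
      - B / (4 * C ^ 2) * (plusPart f x).toReal ^ 2 := by
  have h1 := norm_sq_le_of_operator_step hS hy hz
  have h2 := norm_sq_le_of_feasibility_step hS hb hC hz hfz hd hsub (hbd y hy.1) hx'
  have h3 := plusPart_toReal_le_add hne hbd hx hy.1
  set p := (plusPart f x).toReal
  set q := (plusPart f y).toReal
  have hp : 0 ≤ p := plusPart_toReal_nonneg
  have h4 : p ^ 2 ≤ 2 * q ^ 2 + 2 * C ^ 2 * ‖x - y‖ ^ 2 := by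
    nlinarith [pow_le_pow_left₀ hp h3 2, sq_nonneg (q - C * ‖x - y‖)]
  have h5 : B / (4 * C ^ 2) * p ^ 2 ≤ B / (2 * C ^ 2) * q ^ 2 + B / 2 * ‖x - y‖ ^ 2 := by
    refine (mul_le_mul_of_nonneg_left h4 (by positivity)).trans (le_of_eq ?_)
    field_simp
    ring
  have h6 : B / (2 * C ^ 2) * q ^ 2 ≤ b * (2 - b) / C ^ 2 * q ^ 2 := by
    refine mul_le_mul_of_nonneg_right ?_ (sq_nonneg _)
    rw [div_le_div_iff₀ (by positivity) (by positivity)]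
    nlinarith [sq_nonneg C, mul_nonneg hB0 (sq_nonneg C)]
  -- Since `b (2 - b) ≤ 1`, the transfer cost `B / 2 * ‖x - y‖²` fits into the available half.
  have h7 : B ≤ 1 := by nlinarith [sq_nonneg (b - 1)]
  have h8 : B / 2 * ‖x - y‖ ^ 2 ≤ 1 / 2 * ‖x - y‖ ^ 2 :=
    mul_le_mul_of_nonneg_right (by linarith) (sq_nonneg _)
  linarith

end AgentStep

/-! ### Integration against a fresh sample -/

section Sampling

variable {Ω : Type*} [MeasurableSpace Ω] {P : Measure Ω} [IsProbabilityMeasure P]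
  {α β : Type*} [MeasurableSpace α] [MeasurableSpace β] {V V' : Ω → α} {Y : Ω → β}

lemma map_prod_of_identDistrib (hV : IdentDistrib V' V P P) (hY : Measurable Y)
    (hind : IndepFun V' Y P) :
    P.map (fun ω => (Y ω, V' ω)) = (P.map Y).prod (P.map V) := by
  rw [(indepFun_iff_map_prod_eq_prod_map_map hY.aemeasurable hV.aemeasurable_fst).1 hind.symm,
    hV.map_eq]

/-- Independence makes the joint law a product, and Tonelli applies. This version requires no
integrability, so it can serve to prove it. -/
lemma lintegral_fresh_sample (hV : IdentDistrib V' V P P) (hY : Measurable Y)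
    (hind : IndepFun V' Y P) {Φ : β × α → ENNReal} (hΦ : Measurable Φ) :
    ∫⁻ ω, Φ (Y ω, V' ω) ∂P = ∫⁻ ω, ∫⁻ ω', Φ (Y ω, V ω') ∂P ∂P := by
  have h1 : ∫⁻ ω, Φ (Y ω, V' ω) ∂P = ∫⁻ p, Φ p ∂(P.map fun ω => (Y ω, V' ω)) :=
    (lintegral_map' hΦ.aemeasurable (hY.aemeasurable.prodMk hV.aemeasurable_fst)).symm
  have hsf : SFinite (P.map V) := inferInstance
  rw [h1, map_prod_of_identDistrib hV hY hind, lintegral_prod _ hΦ.aemeasurable,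
    lintegral_map hΦ.lintegral_prod_right' hY]
  refine lintegral_congr fun ω => ?_
  exact lintegral_map' (hΦ.comp measurable_prodMk_left).aemeasurable hV.aemeasurable_snd

lemma integral_fresh_sample (hV : IdentDistrib V' V P P) (hY : Measurable Y)
    (hind : IndepFun V' Y P) {Φ : β × α → ℝ} (hΦ : Measurable Φ)
    (hint : Integrable (fun ω => Φ (Y ω, V' ω)) P) :
    ∫ ω, Φ (Y ω, V' ω) ∂P = ∫ ω, ∫ ω', Φ (Y ω, V ω') ∂P ∂P := by
  have hYV : AEMeasurable (fun ω => (Y ω, V' ω)) P :=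
    hY.aemeasurable.prodMk hV.aemeasurable_fst
  have h1 : ∫ ω, Φ (Y ω, V' ω) ∂P = ∫ p, Φ p ∂(P.map fun ω => (Y ω, V' ω)) :=
    (integral_map hYV hΦ.aestronglyMeasurable).symm
  have hint' : Integrable Φ (P.map fun ω => (Y ω, V' ω)) :=
    (integrable_map_measure hΦ.aestronglyMeasurable hYV).2 hint
  have hsf : SFinite (P.map V) := inferInstance
  rw [map_prod_of_identDistrib hV hY hind] at h1 hint'
  rw [h1, integral_prod _ hint', integral_map hY.aemeasurable
    hΦ.stronglyMeasurable.integral_prod_right'.aestronglyMeasurable]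
  refine integral_congr_ae (ae_of_all _ fun ω => ?_)
  exact integral_map hV.aemeasurable_snd (hΦ.comp measurable_prodMk_left).aestronglyMeasurable

lemma integrable_integral_fresh_sample (hV : IdentDistrib V' V P P) (hY : Measurable Y)
    (hind : IndepFun V' Y P) {Φ : β × α → ℝ} (hΦ : Measurable Φ)
    (hint : Integrable (fun ω => Φ (Y ω, V' ω)) P) :
    Integrable (fun ω => ∫ ω', Φ (Y ω, V ω') ∂P) P := by
  have hint' : Integrable Φ (P.map fun ω => (Y ω, V' ω)) :=
    (integrable_map_measure hΦ.aestronglyMeasurable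
      (hY.aemeasurable.prodMk hV.aemeasurable_fst)).2 hint
  have hsf : SFinite (P.map V) := inferInstance
  rw [map_prod_of_identDistrib hV hY hind] at hint'
  refine (hint'.integral_prod_left.comp_measurable hY).congr (ae_of_all _ fun ω => ?_)
  exact integral_map hV.aemeasurable_snd (hΦ.comp measurable_prodMk_left).aestronglyMeasurable

end Sampling

/-! ### Conditional bounds at random points -/

section RandomPoint

variable {Ω : Type*} {m0 : MeasurableSpace Ω} {P : Measure Ω} [IsProbabilityMeasure P]
  {𝓕 : MeasurableSpace Ω} {E : Type*} [NormedAddCommGroup E] [SecondCountableTopology E]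
  [MeasurableSpace E] [BorelSpace E] {S : Set E} {φ : E → ℝ} {H : Ω → E → ℝ} {c K : ℝ}

/-- If `φ q ≤ c 𝔼[H(·, q) | 𝓕]` for every fixed `q ∈ S`, the same inequality holds in the mean at
an `𝓕`-measurable random point of `S`. -/
lemma setIntegral_le_of_le_condExp (hm : 𝓕 ≤ m0) (hφ : Continuous φ)
    (hφb : ∀ q ∈ S, |φ q| ≤ K * (1 + ‖q‖ ^ 2))
    (hHm : ∀ q ∈ S, Measurable[m0] fun ω => H ω q) (hHc : ∀ ω, ContinuousOn (H ω) S)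
    (hHb : ∀ ω, ∀ q ∈ S, |H ω q| ≤ K * (1 + ‖q‖ ^ 2))
    (hreg : ∀ q ∈ S, ∀ᵐ ω ∂P, φ q ≤ c * (P[fun ω' => H ω' q | 𝓕]) ω)
    {Z : Ω → E} (hZ : Measurable[𝓕] Z) (hZS : ∀ ω, Z ω ∈ S)
    (hZ2 : Integrable (fun ω => ‖Z ω‖ ^ 2) P) {A : Set Ω} (hA : MeasurableSet[𝓕] A) :
    ∫ ω in A, φ (Z ω) ∂P ≤ c * ∫ ω in A, H ω (Z ω) ∂P := by
  rcases isEmpty_or_nonempty Ω with hΩ | ⟨⟨ω₀⟩⟩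
  · simp [Subsingleton.elim P 0]
  have hy0 := hZS ω₀
  set y0 := Z ω₀
  have hK : 0 ≤ K := nonneg_of_mul_nonneg_left ((abs_nonneg _).trans (hφb y0 hy0)) (by positivity)
  -- Approximation by `𝓕`-measurable simple functions with values in `S`: on each fibre the point is
  -- fixed, and only finitely many null sets occur at each stage.
  let s : ℕ → @SimpleFunc Ω 𝓕 E := fun i => @SimpleFunc.approxOn E Ω _ _ _ 𝓕 Z hZ S y0 hy0 _ i
  have hsS : ∀ i ω, s i ω ∈ S := fun i ω => @SimpleFunc.approxOn_mem E Ω _ _ _ 𝓕 Z hZ S y0 hy0 _ i ω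
  have hslim : ∀ ω, Tendsto (fun i => s i ω) atTop (𝓝 (Z ω)) := fun ω =>
    @SimpleFunc.tendsto_approxOn E Ω _ _ _ 𝓕 Z hZ S y0 hy0 _ ω (subset_closure (hZS ω))
  have hsb : ∀ i ω, ‖s i ω‖ ≤ ‖y0‖ + 2 * ‖Z ω‖ := by
    intro i ω
    have h := @SimpleFunc.edist_approxOn_le E Ω _ _ _ 𝓕 Z hZ S y0 hy0 _ ω i
    rw [edist_dist, edist_dist, ENNReal.ofReal_le_ofReal_iff dist_nonneg, dist_eq_norm,
      dist_eq_norm] at h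
    have h1 := norm_sub_norm_le (s i ω) (Z ω)
    have h2 := norm_sub_le y0 (Z ω)
    change ‖s i ω - Z ω‖ ≤ _ at h
    linarith
  -- The approximants satisfy `‖s i ω‖ ≤ ‖y0‖ + 2‖Z ω‖`, so quadratic growth gives one integrable
  -- majorant for both sides.
  set bound : Ω → ℝ := fun ω => K * (1 + (2 * ‖y0‖ ^ 2 + 8 * ‖Z ω‖ ^ 2)) with hbound
  have hboundint : Integrable bound P :=
    ((integrable_const _).add ((integrable_const _).add (hZ2.const_mul _))).const_mul _
  have hle : ∀ i ω, K * (1 + ‖s i ω‖ ^ 2) ≤ bound ω := by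
    intro i ω
    refine mul_le_mul_of_nonneg_left ?_ hK
    nlinarith [pow_le_pow_left₀ (norm_nonneg _) (hsb i ω) 2, sq_nonneg (‖y0‖ - 2 * ‖Z ω‖)]
  have hfib : ∀ i q, MeasurableSet[𝓕] (A ∩ s i ⁻¹' {q}) := fun i q =>
    hA.inter (@SimpleFunc.measurableSet_fiber Ω E 𝓕 (s i) q)
  have hunion : ∀ i, (⋃ q ∈ (s i).range, A ∩ s i ⁻¹' {q}) = A := by
    intro i
    ext ω
    simp only [Set.mem_iUnion, Set.mem_inter_iff, Set.mem_preimage, Set.mem_singleton_iff]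
    exact ⟨fun ⟨_, _, h, _⟩ => h, fun h => ⟨s i ω, SimpleFunc.mem_range_self _ _, h, rfl⟩⟩
  have hdisj : ∀ i, (↑(s i).range : Set E).Pairwise
      (Function.onFun Disjoint fun q => A ∩ s i ⁻¹' {q}) := by
    intro i q _ q' _ hne
    refine Set.disjoint_left.2 fun ω h1 h2 => hne ?_
    rw [← h1.2, ← h2.2]
  have hrange : ∀ i, ∀ q ∈ (s i).range, q ∈ S := by
    intro i q hq
    obtain ⟨ω, rfl⟩ := SimpleFunc.mem_range.1 hq
    exact hsS i ω
  have hHint : ∀ q ∈ S, Integrable (fun ω => H ω q) P := fun q hq =>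
    (integrable_const (K * (1 + ‖q‖ ^ 2))).mono' (hHm q hq).aestronglyMeasurable
      (ae_of_all _ fun ω => hHb ω q hq)
  have hfibH : ∀ i, ∀ q ∈ (s i).range,
      IntegrableOn (fun ω => H ω (s i ω)) (A ∩ s i ⁻¹' {q}) P := by
    intro i q hq
    refine ((hHint q (hrange i q hq)).integrableOn).congr_fun (fun ω hω => ?_)
      (hm _ (hfib i q))
    rw [show s i ω = q from hω.2]
  have hfibφ : ∀ i, ∀ q ∈ (s i).range,
      IntegrableOn (fun ω => φ (s i ω)) (A ∩ s i ⁻¹' {q}) P := by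
    intro i q hq
    refine (integrable_const (φ q)).integrableOn.congr_fun (fun ω hω => ?_) (hm _ (hfib i q))
    rw [show s i ω = q from hω.2]
  have hstep : ∀ i, ∫ ω in A, φ (s i ω) ∂P ≤ c * ∫ ω in A, H ω (s i ω) ∂P := by
    intro i
    rw [← hunion i, integral_biUnion_finset _ (fun q _ => hm _ (hfib i q)) (hdisj i) (hfibφ i),
      integral_biUnion_finset _ (fun q _ => hm _ (hfib i q)) (hdisj i) (hfibH i), Finset.mul_sum]
    refine Finset.sum_le_sum fun q hq => ?_
    have e1 : ∫ ω in A ∩ s i ⁻¹' {q}, φ (s i ω) ∂P = ∫ ω in A ∩ s i ⁻¹' {q}, φ q ∂P :=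
      setIntegral_congr_fun (hm _ (hfib i q)) fun ω hω => by
        rw [show s i ω = q from hω.2]
    have e2 : ∫ ω in A ∩ s i ⁻¹' {q}, H ω (s i ω) ∂P = ∫ ω in A ∩ s i ⁻¹' {q}, H ω q ∂P :=
      setIntegral_congr_fun (hm _ (hfib i q)) fun ω hω => by
        rw [show s i ω = q from hω.2]
    rw [e1, e2, ← setIntegral_condExp hm (hHint q (hrange i q hq)) (hfib i q),
      ← integral_const_mul]
    exact setIntegral_mono_ae (integrable_const _).integrableOn
      (integrable_condExp.const_mul c).integrableOn (hreg q (hrange i q hq))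
  have hHmeas : ∀ i, AEStronglyMeasurable[m0] (fun ω => H ω (s i ω)) (P.restrict A) := by
    intro i
    have := (integrableOn_finset_iUnion (s := (s i).range)).2 (hfibH i)
    rw [hunion i] at this
    exact this.aestronglyMeasurable
  have hφmeas : ∀ i, AEStronglyMeasurable[m0] (fun ω => φ (s i ω)) (P.restrict A) := by
    intro i
    have := (integrableOn_finset_iUnion (s := (s i).range)).2 (hfibφ i)
    rw [hunion i] at this
    exact this.aestronglyMeasurable
  have hlimφ : Tendsto (fun i => ∫ ω in A, φ (s i ω) ∂P) atTop (𝓝 (∫ ω in A, φ (Z ω) ∂P)) :=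
    tendsto_integral_of_dominated_convergence bound hφmeas hboundint.integrableOn
      (fun i => ae_of_all _ fun ω => (hφb _ (hsS i ω)).trans (hle i ω))
      (ae_of_all _ fun ω => (hφ.tendsto _).comp (hslim ω))
  have hlimH : Tendsto (fun i => ∫ ω in A, H ω (s i ω) ∂P) atTop (𝓝 (∫ ω in A, H ω (Z ω) ∂P)) :=
    tendsto_integral_of_dominated_convergence bound hHmeas hboundint.integrableOn
      (fun i => ae_of_all _ fun ω => (hHb ω _ (hsS i ω)).trans (hle i ω))
      (ae_of_all _ fun ω => ((hHc ω) _ (hZS ω)).tendsto.comp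
        (tendsto_nhdsWithin_iff.2 ⟨hslim ω, Eventually.of_forall fun i => hsS i ω⟩))
  exact le_of_tendsto_of_tendsto' hlimφ (hlimH.const_mul c) hstep

end RandomPoint

/-! ### Fresh samples integrated over events of the past -/

section FreshSampleSet

variable {Ω : Type*} {𝓕 m0 : MeasurableSpace Ω} {P : Measure Ω} [IsProbabilityMeasure P]
  {α β : Type*} [MeasurableSpace α] [MeasurableSpace β] {V V' : Ω → α} {Y : Ω → β}

lemma indepFun_of_indep_comap (hind : Indep (MeasurableSpace.comap V' inferInstance) 𝓕 P)
    (hY : Measurable[𝓕] Y) : IndepFun V' Y P :=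
  (IndepFun_iff_Indep _ _ _).2 (indep_of_indep_of_le_right hind hY.comap_le)

/-- The indicator of `A` is adjoined to `Y` as a further coordinate independent of the sample, which
reduces the claim to the integral over the whole space. -/
lemma setIntegral_fresh_sample (hm : 𝓕 ≤ m0) (hV : IdentDistrib V' V P P)
    (hind : Indep (MeasurableSpace.comap V' inferInstance) 𝓕 P) (hY : Measurable[𝓕] Y)
    {Ψ : β × α → ℝ} (hΨ : Measurable Ψ) (hint : Integrable (fun ω => Ψ (Y ω, V' ω)) P)
    {A : Set Ω} (hA : MeasurableSet[𝓕] A) :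
    ∫ ω in A, Ψ (Y ω, V' ω) ∂P = ∫ ω in A, ∫ ω', Ψ (Y ω, V ω') ∂P ∂P := by
  have hY' : Measurable[𝓕] fun ω => (Y ω, A.indicator (fun _ => (1 : ℝ)) ω) :=
    hY.prodMk (measurable_const.indicator hA)
  have hΦ : Measurable fun p : (β × ℝ) × α => p.1.2 * Ψ (p.1.1, p.2) := by fun_prop
  have e : ∀ (f : Ω → ℝ) ω, A.indicator (fun _ => (1 : ℝ)) ω * f ω = A.indicator f ω := by
    intro f ω
    by_cases h : ω ∈ A <;> simp [h]
  have h := integral_fresh_sample hV (hY'.mono hm le_rfl) (indepFun_of_indep_comap hind hY') hΦ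
    ((hint.indicator (hm _ hA)).congr (ae_of_all _ fun ω => (e _ ω).symm))
  simp only [integral_const_mul] at h
  rw [← integral_indicator (hm _ hA), ← integral_indicator (hm _ hA)]
  refine (integral_congr_ae (ae_of_all _ fun ω => ?_)).trans
    (h.trans (integral_congr_ae (ae_of_all _ fun ω => ?_)))
  · exact (e (fun ω => Ψ (Y ω, V' ω)) ω).symm
  · exact e (fun ω => ∫ ω', Ψ (Y ω, V ω') ∂P) ω

end FreshSampleSet

section Model

variable {m : ℕ} {n : Fin m → ℕ} {Ω : Type*} [MeasurableSpace Ω] {P : Measure Ω}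
  {Ξ : Fin m → Type*} [∀ j, MeasurableSpace (Ξ j)]
  {I : Fin m → Type*} [∀ j, MeasurableSpace (I j)]
  {X₀ : ∀ j, Set (Block n j)} {g : ∀ j, I j → Block n j → EReal}
  {F : ∀ j, Ξ j → Prd n → Block n j} {v : Ω → ∀ j, Ξ j} {X : Set (Prd n)}

/-! ### The random operator -/

lemma measurable_toLp_of_apply {u : Ω → Prd n} (h : ∀ j, Measurable fun ω => u ω j) :
    Measurable u :=
  (WithLp.measurable_toLp 2 (∀ j, Block n j)).comp (measurable_pi_lambda _ h)

@[fun_prop] lemma measurable_apply_prd (j : Fin m) : Measurable fun x : Prd n => x j :=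
  (PiLp.continuous_apply 2 _ j).measurable

lemma measurable_fullOp (hF : ∀ j, Measurable fun p : Ξ j × Prd n => F j p.1 p.2) :
    Measurable fun p : Prd n × (∀ j, Ξ j) => fullOp F p.2 p.1 :=
  measurable_toLp_of_apply fun j => (hF j).comp
    (((measurable_pi_apply j).comp measurable_snd).prodMk measurable_fst)

variable [IsProbabilityMeasure P]

lemma OperatorAssumption.meanOp_lipschitz (hop : OperatorAssumption P v F X) :
    ∃ ℓ ≥ 0, ∀ x y, ‖meanOp P v F y - meanOp P v F x‖ ≤ ℓ * ‖y - x‖ := by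
  obtain ⟨L, hLm, hL0, hL2, hL⟩ := hop.lipschitz
  have hLi : Integrable (fun ω => L (v ω)) P :=
    ((memLp_two_iff_integrable_sq
      (hLm.comp hop.measurable_v).aestronglyMeasurable).2 hL2).integrable one_le_two
  refine ⟨∫ ω, L (v ω) ∂P, integral_nonneg fun ω => hL0 _, fun x y => ?_⟩
  rw [meanOp, meanOp, ← integral_sub (hop.integrable y) (hop.integrable x), ← integral_mul_const]
  refine norm_integral_le_of_norm_le (hLi.mul_const _) ?_
  filter_upwards [hL] with ω hω using hω x y

/-- Finite variance is assumed only on `X`; comparing with one feasible point through the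
square-integrable Lipschitz modulus extends it everywhere, with quadratic growth. -/
lemma OperatorAssumption.exists_second_moment_bound (hop : OperatorAssumption P v F X)
    (hX : X.Nonempty) :
    ∃ S ≥ 0, ∀ x, MemLp (fun ω => fullOp F (v ω) x) 2 P ∧
      ∫ ω, ‖fullOp F (v ω) x‖ ^ 2 ∂P ≤ S * (1 + ‖x‖ ^ 2) := by
  obtain ⟨L, hLm, hL0, hL2, hL⟩ := hop.lipschitz
  obtain ⟨z, hz⟩ := hX
  have hz2 := hop.second_moment z hz
  have hLp : MemLp (fun ω => L (v ω)) 2 P :=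
    (memLp_two_iff_integrable_sq (hLm.comp hop.measurable_v).aestronglyMeasurable).2 hL2
  have hzi : Integrable (fun ω => ‖fullOp F (v ω) z‖ ^ 2) P := hz2.integrable_norm_pow two_ne_zero
  have hA : 0 ≤ ∫ ω, ‖fullOp F (v ω) z‖ ^ 2 ∂P := integral_nonneg fun ω => sq_nonneg _
  have hΛ : 0 ≤ ∫ ω, L (v ω) ^ 2 ∂P := integral_nonneg fun ω => sq_nonneg _
  set A := ∫ ω, ‖fullOp F (v ω) z‖ ^ 2 ∂P with hAdef
  set Λ := ∫ ω, L (v ω) ^ 2 ∂P with hΛdef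
  refine ⟨2 * A + 4 * Λ * (1 + ‖z‖ ^ 2), by positivity, fun x => ?_⟩
  have hb : ∀ᵐ ω ∂P, ‖fullOp F (v ω) x‖ ≤ ‖fullOp F (v ω) z‖ + L (v ω) * ‖x - z‖ := by
    filter_upwards [hL] with ω hω
    have := norm_sub_norm_le (fullOp F (v ω) x) (fullOp F (v ω) z)
    linarith [hω z x]
  have hmem : MemLp (fun ω => fullOp F (v ω) x) 2 P := by
    refine (hz2.norm.add (hLp.mul_const ‖x - z‖)).of_le (hop.integrable x).aestronglyMeasurable ?_
    filter_upwards [hb] with ω hω using hω.trans (le_abs_self _)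
  refine ⟨hmem, ?_⟩
  have h1 : ∫ ω, ‖fullOp F (v ω) x‖ ^ 2 ∂P ≤
      ∫ ω, (2 * ‖fullOp F (v ω) z‖ ^ 2 + 2 * ‖x - z‖ ^ 2 * L (v ω) ^ 2) ∂P := by
    refine integral_mono_ae (hmem.integrable_norm_pow two_ne_zero)
      ((hzi.const_mul _).add (hL2.const_mul _)) ?_
    filter_upwards [hb] with ω hω
    have := pow_le_pow_left₀ (norm_nonneg _) hω 2
    nlinarith [sq_nonneg (‖fullOp F (v ω) z‖ - L (v ω) * ‖x - z‖)]
  rw [integral_add (hzi.const_mul _) (hL2.const_mul _), integral_const_mul, integral_const_mul,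
    ← hAdef, ← hΛdef] at h1
  have h2 : ‖x - z‖ ^ 2 ≤ 2 * ‖x‖ ^ 2 + 2 * ‖z‖ ^ 2 := by
    have := pow_le_pow_left₀ (norm_nonneg _) (norm_sub_le x z) 2
    nlinarith [sq_nonneg (‖x‖ - ‖z‖)]
  have h3 := mul_le_mul_of_nonneg_right h2 hΛ
  nlinarith [mul_nonneg hA (sq_nonneg ‖x‖), mul_nonneg (mul_nonneg hΛ (sq_nonneg ‖x‖))
    (sq_nonneg ‖z‖)]

/-! ### The feasible set -/

lemma ConstraintStructure.isClosed_agentSet (h : ConstraintStructure X₀ g) (j : Fin m) :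
    IsClosed (agentSet X₀ g j) :=
  (h.closed_hard j).inter (isClosed_iInter (h.closed_soft j))

lemma ConstraintStructure.convex_agentSet (h : ConstraintStructure X₀ g) (j : Fin m) :
    Convex ℝ (agentSet X₀ g j) :=
  (h.convex_hard j).inter (convex_iInter fun i => (h.convex_soft j i).convex_sublevel)

lemma ConstraintStructure.isClosed_feasSet (h : ConstraintStructure X₀ g) :
    IsClosed (feasSet X₀ g) := by
  have : feasSet X₀ g = ⋂ j, (fun x : Prd n => x j) ⁻¹' agentSet X₀ g j := by
    ext x; simp [feasSet]
  rw [this]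
  exact isClosed_iInter fun j => (h.isClosed_agentSet j).preimage (PiLp.continuous_apply 2 _ j)

lemma ConstraintStructure.convex_feasSet (h : ConstraintStructure X₀ g) :
    Convex ℝ (feasSet X₀ g) :=
  fun _ hx _ hy _ _ ha hb hab j => h.convex_agentSet j (hx j) (hy j) ha hb hab

/-- The squared distance to `X`, computed blockwise. -/
noncomputable def feasDistSq (X₀ : ∀ j, Set (Block n j)) (g : ∀ j, I j → Block n j → EReal) (x : Prd n) : ℝ :=
  ∑ j, Metric.infDist (x j) (agentSet X₀ g j) ^ 2

lemma ConstraintStructure.exists_norm_sub_sq_eq (h : ConstraintStructure X₀ g)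
    (hne : (feasSet X₀ g).Nonempty) (x : Prd n) :
    ∃ p ∈ feasSet X₀ g, ‖x - p‖ ^ 2 = feasDistSq X₀ g x := by
  obtain ⟨z, hz⟩ := hne
  choose p hp using fun j => exists_isProj ⟨z j, hz j⟩ (h.isClosed_agentSet j)
    (h.convex_agentSet j) (x j)
  refine ⟨WithLp.toLp 2 p, fun j => (hp j).1, ?_⟩
  rw [PiLp.norm_sq_eq_of_L2, feasDistSq]
  refine Finset.sum_congr rfl fun j _ => ?_
  rw [(hp j).infDist_eq]
  rfl

lemma ConstraintStructure.exists_subdiff_bound [NeZero m] (h : ConstraintStructure X₀ g) :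
    ∃ C > 0, ∀ j i, ∀ x ∈ X₀ j, ∀ d ∈ subdiff (plusPart (g j i)) x, ‖d‖ ≤ C := by
  choose C hC0 hC using h.subdiff_bounded
  refine ⟨rowMax C, (hC0 0).trans_le (le_rowMax C 0), fun j i x hx d hd => ?_⟩
  exact (hC j i x hx d hd).trans (le_rowMax C j)

lemma ConstraintStructure.continuousOn_plusPart (h : ConstraintStructure X₀ g) (j : Fin m)
    (i : I j) : ContinuousOn (fun x => (plusPart (g j i) x).toReal) (X₀ j) := by
  obtain ⟨C, hC0, hC⟩ := h.subdiff_bounded j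
  refine LipschitzOnWith.continuousOn (K := C.toNNReal) (LipschitzOnWith.of_dist_le_mul ?_)
  intro x hx y hy
  rw [Real.coe_toNNReal _ hC0.le, Real.dist_eq, dist_eq_norm, abs_sub_le_iff]
  have h1 := plusPart_toReal_le_add (h.subdiff_nonempty j i) (hC i) hx hy
  have h2 := plusPart_toReal_le_add (h.subdiff_nonempty j i) (hC i) hy hx
  rw [norm_sub_rev] at h2
  exact ⟨by linarith, by linarith⟩

lemma ConstraintStructure.measurable_plusPart_index (h : ConstraintStructure X₀ g) (j : Fin m)
    {x : Block n j} (hx : x ∈ X₀ j) : Measurable fun i => (plusPart (g j i) x).toReal :=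
  ((h.measurable_soft j x hx).max measurable_const).ereal_toReal

/-- A Carathéodory argument: measurability in the index and continuity in the point on `X₀ j` give
joint measurability, hence measurability at random arguments. -/
lemma ConstraintStructure.measurable_plusPart (h : ConstraintStructure X₀ g) (j : Fin m)
    {y : Ω → Block n j} {i : Ω → I j} (hy : Measurable y) (hyX : ∀ ω, y ω ∈ X₀ j)
    (hi : Measurable i) : Measurable fun ω => (plusPart (g j (i ω)) (y ω)).toReal := by
  have h1 : Measurable (Function.uncurry fun (x : X₀ j) i => (plusPart (g j i) x).toReal) :=
    measurable_uncurry_of_continuous_of_measurable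
      (fun i => (h.continuousOn_plusPart j i).domRestrict)
      (fun x => h.measurable_plusPart_index j x.2)
  exact h1.comp ((hy.subtype_mk (h := hyX)).prodMk hi)

/-! ### Measurability of the iterates -/

lemma ConstraintStructure.measurable_operator_step (h : ConstraintStructure X₀ g)
    (hF : ∀ j, Measurable fun p : Ξ j × Prd n => F j p.1 p.2) {a e : Fin m → ℝ}
    {x y : Ω → Prd n} {ξ : Ω → ∀ j, Ξ j} (hx : Measurable x) (hξ : Measurable ξ)
    (hstep : ∀ ω j, IsProj (X₀ j) (x ω j - a j • (F j (ξ ω j) (x ω) + e j • x ω j)) (y ω j)) :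
    Measurable y := by
  refine measurable_toLp_of_apply fun j =>
    measurable_of_isProj (h.closed_hard j) (h.convex_hard j) ?_ fun ω => hstep ω j
  have h1 : Measurable fun ω => F j (ξ ω j) (x ω) :=
    (hF j).comp (((measurable_pi_apply j).comp hξ).prodMk hx)
  have h2 : Measurable fun ω => x ω j := (measurable_apply_prd j).comp hx
  exact h2.sub ((h1.add (h2.const_smul (e j))).const_smul (a j))

lemma ConstraintStructure.measurable_feasibility_step (h : ConstraintStructure X₀ g)
    {b : Fin m → ℝ} {x' y d : Ω → Prd n} {i : Ω → ∀ j, I j} (hy : Measurable y)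
    (hd : Measurable d) (hi : Measurable i) (hyX : ∀ ω j, y ω j ∈ X₀ j)
    (hstep : ∀ ω j, IsProj (X₀ j)
      (y ω j - (b j * (plusPart (g j (i ω j)) (y ω j)).toReal / ‖d ω j‖ ^ 2) • d ω j) (x' ω j)) :
    Measurable x' := by
  refine measurable_toLp_of_apply fun j =>
    measurable_of_isProj (h.closed_hard j) (h.convex_hard j) ?_ fun ω => hstep ω j
  have h1 : Measurable fun ω => y ω j := (measurable_apply_prd j).comp hy
  have h2 : Measurable fun ω => d ω j := (measurable_apply_prd j).comp hd
  have h3 := h.measurable_plusPart j h1 (fun ω => hyX ω j) ((measurable_pi_apply j).comp hi)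
  exact h1.sub (((h3.const_mul _).div (h2.norm.pow_const 2)).smul h2)

end Model

/-! ### The history σ-algebras -/

section History

variable {m : ℕ} {Ω : Type*} {Ξ : Fin m → Type*} [∀ j, MeasurableSpace (Ξ j)]
  {I : Fin m → Type*} [∀ j, MeasurableSpace (I j)] {w : ℕ → Ω → ∀ j, I j} {vs : ℕ → Ω → ∀ j, Ξ j}

lemma history_mono : Monotone (history w vs) := fun _ _ hkl =>
  iSup₂_le fun i hi => le_iSup₂_of_le i (hi.trans_le hkl) le_rfl

lemma history_le [m0 : MeasurableSpace Ω] (hw : ∀ k, Measurable (w k))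
    (hvs : ∀ k, Measurable (vs k)) (k : ℕ) : history w vs k ≤ m0 :=
  iSup₂_le fun i _ => sup_le (hw i).comap_le (hvs i).comap_le

lemma measurable_control_history (k : ℕ) : Measurable[history w vs (k + 1)] (w k) := by
  rw [measurable_iff_comap_le]
  exact le_sup_left.trans (le_iSup₂_of_le (f := fun i (_ : i < k + 1) =>
    MeasurableSpace.comap (w i) MeasurableSpace.pi ⊔ MeasurableSpace.comap (vs i)
      MeasurableSpace.pi) k (Nat.lt_succ_self k) le_rfl)

lemma measurable_sample_history (k : ℕ) : Measurable[history w vs (k + 1)] (vs k) := by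
  rw [measurable_iff_comap_le]
  exact le_sup_right.trans (le_iSup₂_of_le (f := fun i (_ : i < k + 1) =>
    MeasurableSpace.comap (w i) MeasurableSpace.pi ⊔ MeasurableSpace.comap (vs i)
      MeasurableSpace.pi) k (Nat.lt_succ_self k) le_rfl)

end History

/-! ### Measurability and square integrability of the iterates -/

section Run

variable {m : ℕ} {n : Fin m → ℕ} {Ω : Type*} [MeasurableSpace Ω] {P : Measure Ω}
  [IsProbabilityMeasure P]
  {Ξ : Fin m → Type*} [∀ j, MeasurableSpace (Ξ j)]
  {I : Fin m → Type*} [∀ j, MeasurableSpace (I j)]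
  {X₀ : ∀ j, Set (Block n j)} {g : ∀ j, I j → Block n j → EReal}
  {F : ∀ j, Ξ j → Prd n → Block n j} {v : Ω → ∀ j, Ξ j} {X : Set (Prd n)}
  {vs : ℕ → Ω → ∀ j, Ξ j} {w : ℕ → Ω → ∀ j, I j} {α β : ℕ → Fin m → ℝ} {ε : ℤ → Fin m → ℝ}
  {x0 : Prd n} {x y d : ℕ → Ω → Prd n}

lemma IsRun.measurable_iterate (hrun : IsRun X₀ g F α β ε w vs x0 x y d)
    (h : ConstraintStructure X₀ g) (hF : ∀ j, Measurable fun p : Ξ j × Prd n => F j p.1 p.2)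
    (k : ℕ) : Measurable[history w vs k] (x k) := by
  induction k with
  | zero =>
    rw [show x 0 = fun _ => x0 from funext hrun.init]
    exact measurable_const
  | succ k ih =>
    have ih' : Measurable[history w vs (k + 1)] (x k) := ih.mono (history_mono k.le_succ) le_rfl
    have hy : Measurable[history w vs (k + 1)] (y k) :=
      @ConstraintStructure.measurable_operator_step _ _ _ (history w vs (k + 1)) _ _ _ _ _ _ _ h
        hF _ _ _ _ _ ih' (measurable_sample_history k) (hrun.operator_step k)
    exact @ConstraintStructure.measurable_feasibility_step _ _ _ (history w vs (k + 1)) _ _ _ _ h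
      _ _ _ _ _ hy (hrun.direction_measurable k) (measurable_control_history k)
      (fun ω j => (hrun.operator_step k ω j).1) (hrun.feasibility_step k)

/-- The starting point need not satisfy the hard constraints, which is why the later recursion
begins at `x 1`. -/
lemma IsRun.iterate_mem (hrun : IsRun X₀ g F α β ε w vs x0 x y d) (k : ℕ) (ω : Ω) (j : Fin m) :
    x (k + 1) ω j ∈ X₀ j := (hrun.feasibility_step k ω j).1

/-- The regularized sampled operator `F(v^k, x^k) + diag(ε_k) x^k`. -/
def sampledOp (F : ∀ j, Ξ j → Prd n → Block n j) (e : Fin m → ℝ) (p : Prd n × ∀ j, Ξ j) : Prd n :=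
  fullOp F p.2 p.1 + scale e p.1

lemma measurable_sampledOp (hF : ∀ j, Measurable fun p : Ξ j × Prd n => F j p.1 p.2)
    (e : Fin m → ℝ) : Measurable (sampledOp F e) :=
  (measurable_fullOp hF).add ((continuous_scale e).measurable.comp measurable_fst)

lemma memLp_scale {u : Ω → Prd n} (hu : MemLp u 2 P) (c : Fin m → ℝ) :
    MemLp (fun ω => scale c (u ω)) 2 P := by
  refine hu.of_le_mul (c := ∑ j, |c j|)
    ((continuous_scale c).comp_aestronglyMeasurable hu.aestronglyMeasurable) ?_
  exact ae_of_all _ fun ω => norm_scale_le (Finset.sum_nonneg fun j _ => abs_nonneg _)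
    (fun j => Finset.single_le_sum (f := fun j => |c j|) (fun i _ => abs_nonneg _)
      (Finset.mem_univ j)) _

lemma OperatorAssumption.memLp_sampledOp (hop : OperatorAssumption P v F X)
    (hX : X.Nonempty) (x : Prd n) (e : Fin m → ℝ) :
    MemLp (fun ω => sampledOp F e (x, v ω)) 2 P := by
  obtain ⟨S, _, hS⟩ := hop.exists_second_moment_bound hX
  exact (hS x).1.add (memLp_const (scale e x))

/-- Integrating out the fresh sample first replaces the squared norm by a quadratic function of `u`,
integrable by hypothesis. -/
lemma memLp_sampledOp_iterate (hop : OperatorAssumption P v F X) (hX : X.Nonempty)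
    (hsamp : SamplingAssumption P v vs w) {k : ℕ} {u : Ω → Prd n}
    (hu : Measurable[history w vs k] u) (hu2 : MemLp u 2 P) (e : Fin m → ℝ) :
    MemLp (fun ω => sampledOp F e (u ω, vs k ω)) 2 P := by
  have hm := history_le hsamp.measurable_w hsamp.measurable_vs k
  have hum := hu.mono hm le_rfl
  refine MemLp.add ?_ (memLp_scale hu2 e)
  have hmeas : Measurable fun ω => fullOp F (vs k ω) (u ω) :=
    (measurable_fullOp hop.measurable_F).comp (hum.prodMk (hsamp.measurable_vs k))
  refine (memLp_two_iff_integrable_sq_norm hmeas.aestronglyMeasurable).2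
    ⟨(hmeas.norm.pow_const 2).aestronglyMeasurable, ?_⟩
  rw [hasFiniteIntegral_iff_ofReal (ae_of_all _ fun ω => sq_nonneg _)]
  have hΦ : Measurable fun p : Prd n × (∀ j, Ξ j) => ENNReal.ofReal (‖fullOp F p.2 p.1‖ ^ 2) :=
    ((measurable_fullOp hop.measurable_F).norm.pow_const 2).ennreal_ofReal
  rw [lintegral_fresh_sample (hsamp.identDistrib k) hum
    (indepFun_of_indep_comap (hsamp.indep_history k) hu) hΦ]
  obtain ⟨S, hS0, hS⟩ := hop.exists_second_moment_bound hX
  have hint : Integrable (fun ω => S * (1 + ‖u ω‖ ^ 2)) P :=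
    ((integrable_const _).add (hu2.integrable_norm_pow two_ne_zero)).const_mul _
  refine lt_of_le_of_lt (lintegral_mono fun ω => ?_) hint.lintegral_lt_top
  rw [← ofReal_integral_eq_lintegral_ofReal ((hS (u ω)).1.integrable_norm_pow two_ne_zero)
    (ae_of_all _ fun ω => sq_nonneg _)]
  exact ENNReal.ofReal_le_ofReal (hS (u ω)).2

/-- Relative to a feasible `z`, the feasibility step does not increase any block distance and the
projection in the operator step is nonexpansive. Hence `x (k + 1) - z` is dominated by the
unprojected step minus `z`. -/
lemma IsRun.memLp_iterate (hrun : IsRun X₀ g F α β ε w vs x0 x y d)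
    (h : ConstraintStructure X₀ g) (hop : OperatorAssumption P v F (feasSet X₀ g))
    (hX : (feasSet X₀ g).Nonempty) (hsamp : SamplingAssumption P v vs w)
    (hβ : ∀ k j, 0 < β k j ∧ β k j < 2) (k : ℕ) : MemLp (x k) 2 P := by
  induction k with
  | zero =>
    rw [show x 0 = fun _ => x0 from funext hrun.init]
    exact memLp_const _
  | succ k ih =>
    obtain ⟨z, hz⟩ := hX
    have hm := history_le hsamp.measurable_w hsamp.measurable_vs
    have hmeas := fun k => (hrun.measurable_iterate h hop.measurable_F k).mono (hm k) le_rfl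
    have h1 := memLp_scale (memLp_sampledOp_iterate hop ⟨z, hz⟩ hsamp
      (hrun.measurable_iterate h hop.measurable_F k) ih (ε k)) (α k)
    have h2 : MemLp (fun ω => x (k + 1) ω - z) 2 P := by
      refine ((ih.sub h1).sub (memLp_const z)).of_le
        ((hmeas (k + 1)).sub_const z).aestronglyMeasurable (ae_of_all _ fun ω => ?_)
      refine le_of_sq_le_sq ?_ (norm_nonneg _)
      rw [PiLp.norm_sq_eq_of_L2, PiLp.norm_sq_eq_of_L2]
      refine Finset.sum_le_sum fun j _ => ?_
      obtain ⟨C, hC0, hC⟩ := h.subdiff_bounded j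
      have hgz : g j (w k ω j) (z j) ≤ 0 := by
        have := (hz j).2
        simp only [Set.mem_iInter] at this
        exact this _
      have h3 := norm_sq_le_of_feasibility_step (h.convex_hard j) (hβ k j) hC0 (hz j).1 hgz
        (hrun.direction_ne_zero k ω j) (hrun.direction_mem k ω j)
        (hC _ _ (hrun.operator_step k ω j).1) (hrun.feasibility_step k ω j)
      have h4 := pow_le_pow_left₀ (norm_nonneg _)
        ((hrun.operator_step k ω j).norm_sub_le_of_mem (h.convex_hard j) (hz j).1) 2
      have h5 : 0 ≤ β k j * (2 - β k j) / C ^ 2 *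
          (plusPart (g j (w k ω j)) (y k ω j)).toReal ^ 2 := by
        have := (hβ k j).1
        have : 0 < 2 - β k j := by linarith [(hβ k j).2]
        positivity
      exact (h3.trans (by linarith)).trans h4
    simpa [Pi.add_def] using h2.add (memLp_const z)

end Run

/-! ### The conditional one-step estimate -/

section OneStep

variable {m : ℕ} [NeZero m] {n : Fin m → ℕ} {Ω : Type*} [MeasurableSpace Ω] {P : Measure Ω}
  [IsProbabilityMeasure P]
  {Ξ : Fin m → Type*} [∀ j, MeasurableSpace (Ξ j)]
  {I : Fin m → Type*} [∀ j, MeasurableSpace (I j)]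
  {X₀ : ∀ j, Set (Block n j)} {g : ∀ j, I j → Block n j → EReal}
  {F : ∀ j, Ξ j → Prd n → Block n j} {v : Ω → ∀ j, Ξ j} {X : Set (Prd n)}
  {vs : ℕ → Ω → ∀ j, Ξ j} {w : ℕ → Ω → ∀ j, I j} {α β : ℕ → Fin m → ℝ} {ε : ℤ → Fin m → ℝ}
  {x0 : Prd n} {x y d : ℕ → Ω → Prd n}

lemma integrable_inner_of_memLp_two {E : Type*} [NormedAddCommGroup E] [InnerProductSpace ℝ E]
    {f h : Ω → E} (hf : MemLp f 2 P) (hh : MemLp h 2 P) :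
    Integrable (fun ω => inner ℝ (f ω) (h ω)) P := by
  refine ((hf.integrable_norm_pow two_ne_zero).add (hh.integrable_norm_pow two_ne_zero)).mono'
    (hf.aestronglyMeasurable.inner hh.aestronglyMeasurable) (ae_of_all _ fun ω => ?_)
  have h1 := norm_inner_le_norm (𝕜 := ℝ) (f ω) (h ω)
  simp only [Pi.add_apply]
  nlinarith [sq_nonneg (‖f ω‖ - ‖h ω‖), sq_nonneg ‖f ω‖, sq_nonneg ‖h ω‖]

lemma mem_soft_of_mem_agentSet {j : Fin m} {z : Block n j} (hz : z ∈ agentSet X₀ g j) (i : I j) :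
    g j i z ≤ 0 := Set.mem_iInter.1 hz.2 i

/-- The upper bound for `‖x^{k+1} - z‖²` before the feasibility gain. -/
noncomputable def stepEnergy (F : ∀ j, Ξ j → Prd n → Block n j) (a e : Fin m → ℝ) (z : Prd n)
    (p : Prd n × ∀ j, Ξ j) : ℝ :=
  ‖p.1 - z‖ ^ 2 - 2 * inner ℝ (sampledOp F e p) (scale a (p.1 - z)) +
    2 * rowMax a ^ 2 * ‖sampledOp F e p‖ ^ 2

/-- The squared total violation of the sampled constraints. -/
noncomputable def violation (g : ∀ j, I j → Block n j → EReal) (i : ∀ j, I j) (x : Prd n) : ℝ :=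
  ∑ j, (plusPart (g j (i j)) (x j)).toReal ^ 2

lemma relaxMin_pos {k : ℕ} (hβ : ∀ j, 0 < β k j ∧ β k j < 2) : 0 < relaxMin β k := by
  obtain ⟨i, hi⟩ := exists_eq_rowMin (β k)
  obtain ⟨j, hj⟩ := exists_eq_rowMax (β k)
  rw [relaxMin, ← hi, ← hj]
  exact mul_pos (hβ i).1 (by linarith [(hβ j).2])

lemma relaxMin_le {k : ℕ} (hβ : ∀ j, 0 < β k j ∧ β k j < 2) (j : Fin m) :
    relaxMin β k ≤ β k j * (2 - β k j) := by
  obtain ⟨i, hi⟩ := exists_eq_rowMax (β k)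
  refine mul_le_mul (rowMin_le _ j) (by linarith [le_rowMax (β k) j]) ?_ (hβ j).1.le
  rw [← hi]; linarith [(hβ i).2]

lemma IsRun.norm_sub_sq_le (hrun : IsRun X₀ g F α β ε w vs x0 x y d)
    (h : ConstraintStructure X₀ g) (hα : ∀ k j, 0 < α k j)
    (hβ : ∀ k j, 0 < β k j ∧ β k j < 2) {C : ℝ} (hC0 : 0 < C)
    (hC : ∀ j i, ∀ x ∈ X₀ j, ∀ d ∈ subdiff (plusPart (g j i)) x, ‖d‖ ≤ C)
    {z : Prd n} (hz : z ∈ feasSet X₀ g) (k : ℕ) (ω : Ω) (hxk : ∀ j, x k ω j ∈ X₀ j) :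
    ‖x (k + 1) ω - z‖ ^ 2 ≤ stepEnergy F (α k) (ε k) z (x k ω, vs k ω) -
      relaxMin β k / (4 * C ^ 2) * violation g (w k ω) (x k ω) := by
  have e1 : stepEnergy F (α k) (ε k) z (x k ω, vs k ω) -
      relaxMin β k / (4 * C ^ 2) * violation g (w k ω) (x k ω) =
      ∑ j, (‖x k ω j - z j‖ ^ 2 - 2 * (α k j * inner ℝ (F j (vs k ω j) (x k ω) + ε k j • x k ω j)
        (x k ω j - z j)) + 2 * rowMax (α k) ^ 2 * ‖F j (vs k ω j) (x k ω) + ε k j • x k ω j‖ ^ 2 -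
        relaxMin β k / (4 * C ^ 2) * (plusPart (g j (w k ω j)) (x k ω j)).toReal ^ 2) := by
    rw [stepEnergy, violation, ← inner_scale_comm, inner_scale_left, PiLp.norm_sq_eq_of_L2,
      PiLp.norm_sq_eq_of_L2]
    simp only [Finset.sum_sub_distrib, Finset.sum_add_distrib, Finset.mul_sum]
    rfl
  rw [e1, PiLp.norm_sq_eq_of_L2]
  refine Finset.sum_le_sum fun j _ => ?_
  have h1 := norm_sq_le_of_steps (h.convex_hard j) (hβ k j) (relaxMin_pos (hβ k)).le
    (relaxMin_le (hβ k) j) hC0 (hxk j) (hz j).1 (mem_soft_of_mem_agentSet (hz j) (w k ω j))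
    (hrun.direction_ne_zero k ω j) (hrun.direction_mem k ω j) (h.subdiff_nonempty j _)
    (hC j _) (hrun.operator_step k ω j) (hrun.feasibility_step k ω j)
  have h2 : α k j ^ 2 ≤ rowMax (α k) ^ 2 := pow_le_pow_left₀ (hα k j).le (le_rowMax _ j) 2
  have h3 := mul_le_mul_of_nonneg_right h2
    (sq_nonneg ‖F j (vs k ω j) (x k ω) + ε k j • x k ω j‖)
  refine h1.trans ?_
  linarith

lemma measurable_stepEnergy (hF : ∀ j, Measurable fun p : Ξ j × Prd n => F j p.1 p.2)
    (a e : Fin m → ℝ) (z : Prd n) : Measurable (stepEnergy F a e z) := by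
  have h1 := measurable_sampledOp hF e
  have h2 : Measurable fun p : Prd n × (∀ j, Ξ j) => p.1 - z := measurable_fst.sub_const z
  exact ((h2.norm.pow_const 2).sub ((h1.inner ((continuous_scale a).measurable.comp
    h2)).const_mul 2)).add ((h1.norm.pow_const 2).const_mul _)

lemma integrable_stepEnergy {a e : Fin m → ℝ} {z : Prd n} {u : Ω → Prd n} {ξ : Ω → ∀ j, Ξ j}
    (hu : MemLp u 2 P) (hG : MemLp (fun ω => sampledOp F e (u ω, ξ ω)) 2 P) :
    Integrable (fun ω => stepEnergy F a e z (u ω, ξ ω)) P := by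
  have h1 : MemLp (fun ω => u ω - z) 2 P := hu.sub (memLp_const z)
  exact ((h1.integrable_norm_pow two_ne_zero).sub
    ((integrable_inner_of_memLp_two hG (memLp_scale h1 a)).const_mul 2)).add
    ((hG.integrable_norm_pow two_ne_zero).const_mul _)

lemma integral_stepEnergy_le (hop : OperatorAssumption P v F X) (hX : X.Nonempty) {S : ℝ}
    (hS : ∀ x, MemLp (fun ω => fullOp F (v ω) x) 2 P ∧
      ∫ ω, ‖fullOp F (v ω) x‖ ^ 2 ∂P ≤ S * (1 + ‖x‖ ^ 2))
    {a e : Fin m → ℝ} {E₀ : ℝ} (hE₀ : 0 ≤ E₀) (he : ∀ j, |e j| ≤ E₀) (u z : Prd n) :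
    ∫ ω, stepEnergy F a e z (u, v ω) ∂P ≤
      ‖u - z‖ ^ 2 - 2 * inner ℝ (regOp (meanOp P v F) e u) (scale a (u - z)) +
        2 * rowMax a ^ 2 * ((2 * S + 2 * E₀ ^ 2) * (1 + ‖u‖ ^ 2)) := by
  have hG := hop.memLp_sampledOp hX u e
  have hGi : Integrable (fun ω => ‖sampledOp F e (u, v ω)‖ ^ 2) P :=
    hG.integrable_norm_pow two_ne_zero
  have h1 : ∫ ω, inner ℝ (sampledOp F e (u, v ω)) (scale a (u - z)) ∂P =
      inner ℝ (regOp (meanOp P v F) e u) (scale a (u - z)) := by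
    simp only [real_inner_comm (scale a (u - z))]
    rw [integral_inner (hG.integrable one_le_two)]
    congr 1
    simp only [sampledOp]
    rw [integral_add (hop.integrable u) (integrable_const _), regOp, meanOp]
    simp
  have h2 : ∫ ω, ‖sampledOp F e (u, v ω)‖ ^ 2 ∂P ≤ (2 * S + 2 * E₀ ^ 2) * (1 + ‖u‖ ^ 2) := by
    have hFi : Integrable (fun ω => ‖fullOp F (v ω) u‖ ^ 2) P :=
      (hS u).1.integrable_norm_pow two_ne_zero
    have h3 : ∫ ω, ‖sampledOp F e (u, v ω)‖ ^ 2 ∂P ≤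
        ∫ ω, (2 * ‖fullOp F (v ω) u‖ ^ 2 + 2 * (E₀ * ‖u‖) ^ 2) ∂P := by
      refine integral_mono hGi ((hFi.const_mul _).add (integrable_const _)) fun ω => ?_
      have h4 : ‖sampledOp F e (u, v ω)‖ ≤ ‖fullOp F (v ω) u‖ + E₀ * ‖u‖ :=
        (norm_add_le _ _).trans (by gcongr; exact norm_scale_le hE₀ he u)
      have h5 := pow_le_pow_left₀ (norm_nonneg _) h4 2
      simp only
      nlinarith [sq_nonneg (‖fullOp F (v ω) u‖ - E₀ * ‖u‖)]
    rw [integral_add (hFi.const_mul _) (integrable_const _), integral_const_mul] at h3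
    simp only [integral_const, probReal_univ, one_smul] at h3
    nlinarith [(hS u).2, sq_nonneg E₀]
  have hi := integrable_inner_of_memLp_two hG (memLp_const (μ := P) (scale a (u - z)))
  have hi2 : Integrable (fun ω => ‖u - z‖ ^ 2 -
      2 * inner ℝ (sampledOp F e (u, v ω)) (scale a (u - z))) P :=
    (integrable_const _).sub (hi.const_mul 2)
  simp only [stepEnergy]
  rw [integral_add hi2 (hGi.const_mul _),
    integral_sub (integrable_const _) (hi.const_mul 2), integral_const_mul, integral_const_mul, h1]
  simp only [integral_const, probReal_univ, one_smul]
  gcongr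

/-- Distance and violation both vanish at a feasible point, so both squares grow at most
quadratically; this is the domination needed to insert a random point into regularity, block by
block. -/
lemma exists_regularity_bound (hreg : RegularityAssumption P X₀ g w vs)
    (h : ConstraintStructure X₀ g) (hX : (feasSet X₀ g).Nonempty)
    (hsamp : SamplingAssumption P v vs w) :
    ∃ c > 0, ∀ k, ∀ u : Ω → Prd n, Measurable[history w vs k] u → (∀ ω j, u ω j ∈ X₀ j) →
      MemLp u 2 P → Integrable (fun ω => violation g (w k ω) (u ω)) P ∧
        Integrable (fun ω => feasDistSq X₀ g (u ω)) P ∧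
        ∀ A, MeasurableSet[history w vs k] A →
          ∫ ω in A, feasDistSq X₀ g (u ω) ∂P ≤ c * ∫ ω in A, violation g (w k ω) (u ω) ∂P := by
  choose c hc0 hc using hreg
  obtain ⟨z, hz⟩ := hX
  obtain ⟨C, hC0, hC⟩ := h.exists_subdiff_bound
  have hm := history_le hsamp.measurable_w hsamp.measurable_vs
  refine ⟨rowMax c, (hc0 0).trans_le (le_rowMax c 0), fun k u hu huX hu2 => ?_⟩
  have hsq : ∀ j (q : Block n j), ‖q - z j‖ ^ 2 ≤ 2 * (1 + ‖z j‖ ^ 2) * (1 + ‖q‖ ^ 2) := by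
    intro j q
    have h1 := pow_le_pow_left₀ (norm_nonneg _) (norm_sub_le q (z j)) 2
    nlinarith [sq_nonneg (‖q‖ - ‖z j‖), mul_nonneg (sq_nonneg ‖q‖) (sq_nonneg ‖z j‖)]
  have hplus : ∀ j i, ∀ q ∈ X₀ j, (plusPart (g j i) q).toReal ^ 2 ≤ C ^ 2 * ‖q - z j‖ ^ 2 := by
    intro j i q hq
    have h1 := plusPart_toReal_le_add (h.subdiff_nonempty j i) (hC j i) hq (hz j).1
    rw [plusPart_toReal_eq_zero (mem_soft_of_mem_agentSet (hz j) i), zero_add] at h1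
    rw [← mul_pow]
    exact pow_le_pow_left₀ plusPart_toReal_nonneg h1 2
  have hdist : ∀ j (q : Block n j), Metric.infDist q (agentSet X₀ g j) ^ 2 ≤ ‖q - z j‖ ^ 2 :=
    fun j q => pow_le_pow_left₀ Metric.infDist_nonneg
      (dist_eq_norm q (z j) ▸ Metric.infDist_le_dist_of_mem (hz j)) 2
  have hui : ∀ j, Integrable (fun ω => ‖u ω j - z j‖ ^ 2) P := by
    intro j
    refine ((hu2.sub (memLp_const z)).integrable_norm_pow two_ne_zero).mono' ?_
      (ae_of_all _ fun ω => ?_)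
    · exact ((((measurable_apply_prd j).comp (hu.mono (hm k) le_rfl)).sub_const
        (z j)).norm.pow_const 2).aestronglyMeasurable
    · rw [Real.norm_of_nonneg (sq_nonneg _)]
      exact pow_le_pow_left₀ (norm_nonneg _) (PiLp.norm_apply_le (u ω - z) j) 2
  have hum : ∀ j, Measurable[history w vs k] fun ω => u ω j := fun j =>
    (measurable_apply_prd j).comp hu
  have hHi : ∀ j, Integrable (fun ω => (plusPart (g j (w k ω j)) (u ω j)).toReal ^ 2) P := by
    intro j
    refine ((hui j).const_mul (C ^ 2)).mono' ?_ (ae_of_all _ fun ω => ?_)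
    · exact ((h.measurable_plusPart j ((hum j).mono (hm k) le_rfl) (fun ω => huX ω j)
        ((measurable_pi_apply j).comp (hsamp.measurable_w k))).pow_const 2).aestronglyMeasurable
    · rw [Real.norm_of_nonneg (sq_nonneg _)]
      exact hplus j _ _ (huX ω j)
  have hDi : ∀ j, Integrable (fun ω => Metric.infDist (u ω j) (agentSet X₀ g j) ^ 2) P := by
    intro j
    refine (hui j).mono' ?_ (ae_of_all _ fun ω => ?_)
    · exact ((((Metric.continuous_infDist_pt _).measurable.comp ((hum j).mono (hm k)
        le_rfl)).pow_const 2)).aestronglyMeasurable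
    · rw [Real.norm_of_nonneg (sq_nonneg _)]
      exact hdist j _
  refine ⟨integrable_finsetSum _ fun j _ => hHi j, integrable_finsetSum _ fun j _ => hDi j,
    fun A hA => ?_⟩
  simp only [feasDistSq, violation]
  rw [integral_finsetSum _ fun j _ => (hDi j).integrableOn,
    integral_finsetSum _ fun j _ => (hHi j).integrableOn, Finset.mul_sum]
  refine Finset.sum_le_sum fun j _ => ?_
  have hKC : 0 ≤ 2 * (1 + ‖z j‖ ^ 2) * C ^ 2 := by positivity
  have hK1 : 0 ≤ 2 * (1 + ‖z j‖ ^ 2) := by positivity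
  have huj2 : Integrable (fun ω => ‖u ω j‖ ^ 2) P := by
    refine (hu2.integrable_norm_pow two_ne_zero).mono' ?_ (ae_of_all _ fun ω => ?_)
    · exact (((hum j).mono (hm k) le_rfl).norm.pow_const 2).aestronglyMeasurable
    · rw [Real.norm_of_nonneg (sq_nonneg _)]
      exact pow_le_pow_left₀ (norm_nonneg _) (PiLp.norm_apply_le (u ω) j) 2
  have key := setIntegral_le_of_le_condExp (P := P) (S := X₀ j)
    (φ := fun q => Metric.infDist q (agentSet X₀ g j) ^ 2)
    (H := fun ω q => (plusPart (g j (w k ω j)) q).toReal ^ 2) (c := c j)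
    (K := 2 * (1 + ‖z j‖ ^ 2) * (1 + C ^ 2)) (hm k)
    ((Metric.continuous_infDist_pt _).pow 2)
    (fun q _ => by
      rw [abs_of_nonneg (sq_nonneg _)]
      refine (hdist j q).trans ((hsq j q).trans ?_)
      have : 0 ≤ 2 * (1 + ‖z j‖ ^ 2) * C ^ 2 * (1 + ‖q‖ ^ 2) := by positivity
      linarith)
    (fun q hq => ((h.measurable_plusPart_index j hq).comp
      ((measurable_pi_apply j).comp (hsamp.measurable_w k))).pow_const 2)
    (fun ω => (h.continuousOn_plusPart j (w k ω j)).pow 2)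
    (fun ω q hq => by
      rw [abs_of_nonneg (sq_nonneg _)]
      refine (hplus j _ q hq).trans
        ((mul_le_mul_of_nonneg_left (hsq j q) (sq_nonneg C)).trans ?_)
      have : 0 ≤ 2 * (1 + ‖z j‖ ^ 2) * (1 + ‖q‖ ^ 2) := by positivity
      linarith)
    (fun q hq => hc j k q hq) (hum j) (fun ω => huX ω j) huj2 hA
  exact key.trans (mul_le_mul_of_nonneg_right (le_rowMax c j)
    (integral_nonneg fun ω => sq_nonneg _))

/-- The contraction of the mean step towards the regularized solution. -/
lemma drift_le {T : Prd n → Prd n} (hmono : ∀ x y, 0 ≤ inner ℝ (T y - T x) (y - x)) {ℓ : ℝ}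
    (hT : ∀ x y, ‖T y - T x‖ ≤ ℓ * ‖y - x‖) {a e : Fin m → ℝ} (ha : ∀ j, 0 < a j)
    {E₀ N : ℝ} (hE₀ : 0 ≤ E₀) (he : ∀ j, |e j| ≤ E₀) {z p : Prd n}
    (hz : z ∈ solSet (regOp T e) X) (hp : p ∈ X) (hN : ‖regOp T e z‖ ≤ N) (u : Prd n) :
    -2 * inner ℝ (regOp T e u) (scale a (u - z)) ≤
      -2 * (rowMin a * rowMin e) * ‖u - z‖ ^ 2 + 2 * rowMin a * N * ‖u - p‖ +
        2 * (rowMax a - rowMin a) * (((ℓ + E₀) * ‖u - z‖ + N) * ‖u - z‖) := by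
  obtain ⟨i, hi⟩ := exists_eq_rowMin a
  have ha0 : 0 < rowMin a := hi ▸ ha i
  -- Strong monotonicity pairs with a common stepsize only, so the deviations from the smallest one
  -- are treated as an error.
  have hsplit : scale a (u - z) = rowMin a • (u - z) + scale (fun j => a j - rowMin a) (u - z) := by
    ext j : 1
    simp only [scale_apply, PiLp.add_apply, PiLp.smul_apply, sub_smul]
    abel
  have h1 := regOp_strongly_monotone hmono (rowMin_le e) z u
  have h2 : -inner ℝ (regOp T e z) (u - z) ≤ N * ‖u - p‖ := by
    have h3 := hz.2 p hp
    -- As `u` may be infeasible, the inequality for `z` is tested at `p`, and `u - p` is left as the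
    -- error.
    have h4 : u - z = (u - p) + (p - z) := by abel
    rw [h4, inner_add_right]
    have h5 := (abs_le.1 (abs_real_inner_le_norm (regOp T e z) (u - p))).1
    have h6 := mul_le_mul_of_nonneg_right hN (norm_nonneg (u - p))
    linarith
  have h3 : ‖regOp T e u‖ ≤ (ℓ + E₀) * ‖u - z‖ + N := by
    have h4 := regOp_lipschitz hT hE₀ he z u
    have h5 := norm_sub_norm_le (regOp T e u) (regOp T e z)
    linarith
  have hΔ : 0 ≤ rowMax a - rowMin a := sub_nonneg.2 (rowMin_le_rowMax a)
  have h4 : ‖scale (fun j => a j - rowMin a) (u - z)‖ ≤ (rowMax a - rowMin a) * ‖u - z‖ := by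
    refine norm_scale_le hΔ (fun j => ?_) _
    rw [abs_of_nonneg (sub_nonneg.2 (rowMin_le a j))]
    linarith [le_rowMax a j]
  have h5 : -inner ℝ (regOp T e u) (scale (fun j => a j - rowMin a) (u - z)) ≤
      ((ℓ + E₀) * ‖u - z‖ + N) * ((rowMax a - rowMin a) * ‖u - z‖) := by
    have h6 := (abs_le.1 (abs_real_inner_le_norm (regOp T e u)
      (scale (fun j => a j - rowMin a) (u - z)))).1
    have h7 := mul_le_mul h3 h4 (norm_nonneg _) ((norm_nonneg _).trans h3)
    linarith
  rw [inner_sub_left] at h1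
  rw [hsplit, inner_add_right, inner_smul_right]
  have h6 : rowMin a * (rowMin e * ‖u - z‖ ^ 2 - N * ‖u - p‖) ≤
      rowMin a * inner ℝ (regOp T e u) (u - z) :=
    mul_le_mul_of_nonneg_left (by linarith) ha0.le
  linarith

end OneStep

section Convergence

variable {m : ℕ} [NeZero m] {n : Fin m → ℕ} {Ω : Type*} [MeasurableSpace Ω] {P : Measure Ω}
  [IsProbabilityMeasure P]
  {Ξ : Fin m → Type*} [∀ j, MeasurableSpace (Ξ j)]
  {I : Fin m → Type*} [∀ j, MeasurableSpace (I j)]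
  {X₀ : ∀ j, Set (Block n j)} {g : ∀ j, I j → Block n j → EReal}
  {F : ∀ j, Ξ j → Prd n → Block n j} {v : Ω → ∀ j, Ξ j}
  {vs : ℕ → Ω → ∀ j, Ξ j} {w : ℕ → Ω → ∀ j, I j} {α β : ℕ → Fin m → ℝ} {ε : ℤ → Fin m → ℝ}
  {x0 : Prd n} {x y d : ℕ → Ω → Prd n}

/-! ### Stepsizes -/

lemma StepAssumption.rowMin_step_pos (hs : StepAssumption α β ε) (k : ℕ) : 0 < rowMin (α k) := by
  obtain ⟨j, hj⟩ := exists_eq_rowMin (α k)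
  exact hj ▸ hs.step_pos k j

lemma StepAssumption.rowMin_reg_pos (hs : StepAssumption α β ε) (k : ℕ) : 0 < rowMin (ε k) := by
  obtain ⟨j, hj⟩ := exists_eq_rowMin (ε k)
  exact hj ▸ hs.reg_pos k (by omega) j

lemma StepAssumption.stepReg_pos (hs : StepAssumption α β ε) (k : ℕ) : 0 < stepReg α ε k :=
  mul_pos (hs.rowMin_step_pos k) (hs.rowMin_reg_pos k)

lemma StepAssumption.abs_reg_le (hs : StepAssumption α β ε) (k : ℕ) (j : Fin m) :
    |ε k j| ≤ rowMax (ε 0) := by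
  rw [abs_of_pos (hs.reg_pos k (by omega) j)]
  exact (hs.reg_antitone j (by simp) (Set.mem_Ici.2 (by omega)) (by omega)).trans (le_rowMax _ j)

lemma StepAssumption.reg_tendsto_nat (hs : StepAssumption α β ε) (j : Fin m) :
    Tendsto (fun k : ℕ => ε k j) atTop (𝓝 0) :=
  (hs.reg_tendsto j).comp tendsto_natCast_atTop_atTop

lemma StepAssumption.abs_reg_sub_le (hs : StepAssumption α β ε) (k : ℕ) (j : Fin m) :
    |ε k j - ε (k + 1 : ℕ) j| ≤ regGap ε (k + 1) := by
  have h1 : ε (k + 1 : ℕ) j ≤ ε k j :=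
    hs.reg_antitone j (Set.mem_Ici.2 (by omega)) (Set.mem_Ici.2 (by omega)) (by omega)
  rw [abs_of_nonneg (sub_nonneg.2 h1), regGap]
  have h2 : (((k + 1 : ℕ) : ℤ) - 1) = k := by omega
  rw [h2]
  linarith [le_rowMax (ε k) j, rowMin_le (ε (k + 1 : ℕ)) j]

/-- Errors proportional to the squared distance eventually consume at most a quarter of the
contraction `2 * stepReg`. -/
lemma StepAssumption.eventually_small (hs : StepAssumption α β ε) (A B : ℝ) :
    ∀ᶠ k in atTop, 2 * stepGap α k * A + 2 * rowMax (α k) ^ 2 * B ≤ stepReg α ε k / 2 ∧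
      stepReg α ε k ≤ 1 := by
  have h1 := (hs.lim_gap.const_mul (2 * A)).add (hs.lim_step.const_mul (2 * B))
  simp only [mul_zero, add_zero] at h1
  filter_upwards [h1.eventually_lt_const (show (0 : ℝ) < 1 / 2 by norm_num),
    hs.lim_stepReg.eventually_lt_const one_pos] with k hk hk'
  have hq := hs.stepReg_pos k
  refine ⟨?_, hk'.le⟩
  have e : 2 * A * (stepGap α k / stepReg α ε k) + 2 * B * (rowMax (α k) ^ 2 / stepReg α ε k) =
      (2 * stepGap α k * A + 2 * rowMax (α k) ^ 2 * B) / stepReg α ε k := by ring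
  rw [e, div_lt_iff₀ hq] at hk
  linarith

/-! ### The recursion along the Tikhonov trajectory -/

/-- Two uses of Young: `2aNδ` is absorbed by the feasibility gain `κδ²`, and `2ΔNr` by `q/2 * r²`.
With another `q/2` lost to `hsmall`, the rate `2q` drops to `q`. -/
lemma energy_sub_gain_le {φ r δ a A Δ q N κ L S : ℝ} (hδ : 0 ≤ δ) (haA : a ≤ A)
    (hN : 0 ≤ N) (hq : 0 < q) (hκ : 0 < κ)
    (hsmall : 2 * Δ * L + 2 * A ^ 2 * S ≤ q / 2)
    (hφ : φ ≤ r ^ 2 + (-2 * q * r ^ 2 + 2 * a * N * δ + 2 * Δ * ((L * r + N) * r)) +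
      2 * A ^ 2 * (S * (1 + r ^ 2))) :
    φ - κ * δ ^ 2 ≤ (1 - q) * r ^ 2 + (N ^ 2 * A ^ 2 / κ + 2 * N ^ 2 * (Δ ^ 2 / q) +
      2 * S * A ^ 2) := by
  have h1 : 2 * a * N * δ ≤ κ * δ ^ 2 + N ^ 2 * A ^ 2 / κ := by
    have h2 : a * (N * δ) ≤ A * (N * δ) := mul_le_mul_of_nonneg_right haA (mul_nonneg hN hδ)
    have h3 : κ * δ ^ 2 + N ^ 2 * A ^ 2 / κ - 2 * A * N * δ = (κ * δ - N * A) ^ 2 / κ := by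
      field_simp
      ring
    have h4 : 0 ≤ (κ * δ - N * A) ^ 2 / κ := by positivity
    linarith
  have h2 : 2 * Δ * N * r ≤ q / 2 * r ^ 2 + 2 * N ^ 2 * (Δ ^ 2 / q) := by
    have h3 : q / 2 * r ^ 2 + 2 * N ^ 2 * (Δ ^ 2 / q) - 2 * Δ * N * r =
        (q * r - 2 * Δ * N) ^ 2 / (2 * q) := by
      field_simp
      ring
    have h4 : 0 ≤ (q * r - 2 * Δ * N) ^ 2 / (2 * q) := by positivity
    linarith
  have h3 := mul_le_mul_of_nonneg_right hsmall (sq_nonneg r)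
  linarith

/-- All randomness of one step is removed here: the operator sample is integrated out and the
sampled violation replaced by the distance to `X`. What remains is a deterministic inequality in the
current point. -/
lemma IsRun.setIntegral_norm_sub_sq_le (hrun : IsRun X₀ g F α β ε w vs x0 x y d)
    (h : ConstraintStructure X₀ g) (hop : OperatorAssumption P v F (feasSet X₀ g))
    (hX : (feasSet X₀ g).Nonempty) (hsamp : SamplingAssumption P v vs w)
    (hreg : RegularityAssumption P X₀ g w vs) (hs : StepAssumption α β ε) :
    ∃ κ > 0, ∀ z ∈ feasSet X₀ g, ∀ k A, MeasurableSet[history w vs (k + 1)] A →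
      ∀ ψ : Prd n → ℝ, (∀ u, (∫ ω, stepEnergy F (α (k + 1)) (ε (k + 1 : ℕ)) z (u, v ω) ∂P) -
        κ * relaxMin β (k + 1) * feasDistSq X₀ g u ≤ ψ u) →
      Integrable (fun ω => ψ (x (k + 1) ω)) P →
      ∫ ω in A, ‖x (k + 2) ω - z‖ ^ 2 ∂P ≤ ∫ ω in A, ψ (x (k + 1) ω) ∂P := by
  obtain ⟨C, hC0, hC⟩ := h.exists_subdiff_bound
  obtain ⟨c, hc0, hc⟩ := exists_regularity_bound hreg h hX hsamp
  refine ⟨1 / (4 * C ^ 2 * c), by positivity, fun z hz k A hA ψ hψ hψi => ?_⟩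
  set B := relaxMin β (k + 1) with hB
  have hB0 : 0 < B := relaxMin_pos (hs.relax_mem (k + 1))
  have hm := history_le hsamp.measurable_w hsamp.measurable_vs (k + 1)
  have hxm := hrun.measurable_iterate h hop.measurable_F (k + 1)
  have hx2 := fun k => hrun.memLp_iterate h hop hX hsamp hs.relax_mem k
  obtain ⟨hVi, hDi, hVD⟩ := hc (k + 1) (x (k + 1)) hxm (hrun.iterate_mem k) (hx2 _)
  have hGi := memLp_sampledOp_iterate hop hX hsamp hxm (hx2 (k + 1)) (ε (k + 1 : ℕ))
  have hEi := integrable_stepEnergy (a := α (k + 1)) (z := z) (hx2 (k + 1)) hGi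
  have hEm := measurable_stepEnergy hop.measurable_F (α (k + 1)) (ε (k + 1 : ℕ)) z
  have hφi := integrable_integral_fresh_sample (hsamp.identDistrib (k + 1)) (hxm.mono hm le_rfl)
    (indepFun_of_indep_comap (hsamp.indep_history (k + 1)) hxm) hEm hEi
  have hzi : Integrable (fun ω => ‖x (k + 2) ω - z‖ ^ 2) P :=
    ((hx2 (k + 2)).sub (memLp_const z)).integrable_norm_pow two_ne_zero
  calc ∫ ω in A, ‖x (k + 2) ω - z‖ ^ 2 ∂P
      ≤ ∫ ω in A, (stepEnergy F (α (k + 1)) (ε (k + 1 : ℕ)) z (x (k + 1) ω, vs (k + 1) ω) -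
          B / (4 * C ^ 2) * violation g (w (k + 1) ω) (x (k + 1) ω)) ∂P :=
        setIntegral_mono hzi.integrableOn (hEi.sub (hVi.const_mul _)).integrableOn fun ω =>
          hrun.norm_sub_sq_le h hs.step_pos hs.relax_mem hC0 hC hz (k + 1) ω
            (hrun.iterate_mem k ω)
    _ = ∫ ω in A, (∫ ω', stepEnergy F (α (k + 1)) (ε (k + 1 : ℕ)) z (x (k + 1) ω, v ω') ∂P) ∂P -
          B / (4 * C ^ 2) * ∫ ω in A, violation g (w (k + 1) ω) (x (k + 1) ω) ∂P := by
        rw [integral_sub hEi.integrableOn (hVi.const_mul _).integrableOn, integral_const_mul,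
          setIntegral_fresh_sample hm (hsamp.identDistrib (k + 1)) (hsamp.indep_history (k + 1))
            hxm hEm hEi hA]
    _ ≤ ∫ ω in A, (∫ ω', stepEnergy F (α (k + 1)) (ε (k + 1 : ℕ)) z (x (k + 1) ω, v ω') ∂P) ∂P -
          1 / (4 * C ^ 2 * c) * B * ∫ ω in A, feasDistSq X₀ g (x (k + 1) ω) ∂P := by
        have h1 := mul_le_mul_of_nonneg_left (hVD A hA)
          (show 0 ≤ 1 / (4 * C ^ 2 * c) * B by positivity)
        have h2 : ∀ V : ℝ, 1 / (4 * C ^ 2 * c) * B * (c * V) = B / (4 * C ^ 2) * V := by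
          intro V; field_simp
        rw [h2] at h1
        linarith
    _ = ∫ ω in A, ((∫ ω', stepEnergy F (α (k + 1)) (ε (k + 1 : ℕ)) z (x (k + 1) ω, v ω') ∂P) -
          1 / (4 * C ^ 2 * c) * B * feasDistSq X₀ g (x (k + 1) ω)) ∂P := by
        rw [integral_sub hφi.integrableOn (hDi.const_mul _).integrableOn, integral_const_mul]
    _ ≤ ∫ ω in A, ψ (x (k + 1) ω) ∂P :=
        setIntegral_mono (hφi.sub (hDi.const_mul _)).integrableOn hψi.integrableOn fun ω =>
          hψ (x (k + 1) ω)

/-- Perturbation of the squared distance when the Tikhonov point moves by at most `D`. -/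
lemma contraction_shift_le {E : Type*} [NormedAddCommGroup E] (u t t' : E) {q D : ℝ} (hq : 0 < q)
    (hq1 : q ≤ 1) (hD : ‖t - t'‖ ≤ D) :
    (1 - q) * ‖u - t‖ ^ 2 ≤ (1 - q / 2) * ‖u - t'‖ ^ 2 + 2 * (D ^ 2 * (1 + q⁻¹)) := by
  set r := ‖u - t'‖
  have hD0 : 0 ≤ D := (norm_nonneg _).trans hD
  have h1 : ‖u - t‖ ≤ r + D := by
    have := norm_sub_le_norm_sub_add_norm_sub u t' t
    rw [norm_sub_rev t' t] at this
    linarith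
  have h2 := pow_le_pow_left₀ (norm_nonneg _) h1 2
  have h3 : 2 * r * D ≤ q / 2 * r ^ 2 + 2 * q⁻¹ * D ^ 2 := by
    have h4 : q / 2 * r ^ 2 + 2 * q⁻¹ * D ^ 2 - 2 * r * D = (q * r - 2 * D) ^ 2 / (2 * q) := by
      field_simp
      ring
    have h5 : 0 ≤ (q * r - 2 * D) ^ 2 / (2 * q) := by positivity
    linarith
  have h4 : ‖u - t‖ ^ 2 ≤ (1 + q / 2) * r ^ 2 + (1 + 2 * q⁻¹) * D ^ 2 := by nlinarith
  -- The contraction survives the shift because `(1 - q) * (1 + q / 2) ≤ 1 - q / 2`.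
  have h5 := mul_le_mul_of_nonneg_left h4 (sub_nonneg.2 hq1)
  have h6 : 0 ≤ (1 + 2 * q⁻¹) * D ^ 2 := by positivity
  have h7 := mul_nonneg hq.le h6
  nlinarith [mul_nonneg (sq_nonneg q) (sq_nonneg r), sq_nonneg D]

/-- The iterates approach the Tikhonov trajectory almost surely, if the latter is bounded. -/
theorem IsRun.ae_tendsto_norm_sub_sq (hrun : IsRun X₀ g F α β ε w vs x0 x y d)
    (h : ConstraintStructure X₀ g) (hop : OperatorAssumption P v F (feasSet X₀ g))
    (hsamp : SamplingAssumption P v vs w)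
    (hreg : RegularityAssumption P X₀ g w vs) (hs : StepAssumption α β ε) {t : ℕ → Prd n}
    (ht : ∀ k : ℕ, t k ∈ solSet (regOp (meanOp P v F) (ε k)) (feasSet X₀ g)) {M : ℝ}
    (hM : ∀ k, ‖t k‖ ≤ M) :
    ∀ᵐ ω ∂P, Tendsto (fun k => ‖x (k + 1) ω - t k‖ ^ 2) atTop (𝓝 0) := by
  have hX : (feasSet X₀ g).Nonempty := ⟨t 0, (ht 0).1⟩
  set T := meanOp P v F with hT
  obtain ⟨ℓ, hℓ0, hℓ⟩ := hop.meanOp_lipschitz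
  obtain ⟨S, hS0, hS⟩ := hop.exists_second_moment_bound hX
  obtain ⟨κ, hκ, hκstep⟩ := hrun.setIntegral_norm_sub_sq_le h hop hX hsamp hreg hs
  have hM0 : 0 ≤ M := (norm_nonneg _).trans (hM 0)
  set E₀ := rowMax (ε 0) with hE₀
  have hE₀0 : 0 ≤ E₀ := (abs_nonneg _).trans (hs.abs_reg_le 0 0)
  set N := ‖T 0‖ + ℓ * M + E₀ * M with hN
  have hN0 : 0 ≤ N := by positivity
  have hNt : ∀ k : ℕ, ‖regOp T (ε k) (t k)‖ ≤ N := by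
    intro k
    have h1 := norm_le_insert' (T (t k)) (T 0)
    have h2 := hℓ 0 (t k)
    rw [sub_zero] at h2
    have h3 := norm_scale_le hE₀0 (hs.abs_reg_le k) (t k)
    refine (norm_add_le _ _).trans ?_
    have h4 := mul_le_mul_of_nonneg_left (hM k) hℓ0
    have h5 := mul_le_mul_of_nonneg_left (hM k) hE₀0
    linarith
  -- The factor `2 + 2M²` re-centres the quadratic growth from the origin to the Tikhonov points.
  set S' := (2 * S + 2 * E₀ ^ 2) * (2 + 2 * M ^ 2) with hS'
  have hS'0 : 0 ≤ S' := by positivity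
  set q := stepReg α ε with hq
  -- In order: infeasibility, unequal stepsizes, sampling noise, motion of the Tikhonov point.
  set b : ℕ → ℝ := fun k => N ^ 2 * κ⁻¹ * (rowMax (α k) ^ 2 / relaxMin β k) +
    2 * N ^ 2 * (stepGap α k ^ 2 / q k) + 2 * S' * rowMax (α k) ^ 2 +
    2 * M ^ 2 * ((regGap ε k / rowMin (ε k)) ^ 2 *
      (1 + (rowMin (α k))⁻¹ * (rowMin (ε k))⁻¹)) with hb
  have hq0 := hs.stepReg_pos
  have hbs : Summable b := (((hs.sum_relax.mul_left _).add (hs.sum_gap.mul_left _)).add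
    (hs.sum_step.mul_left _)).add (hs.sum_reg.mul_left _)
  have hb0 : ∀ k, 0 ≤ b k := by
    intro k
    have h1 := (relaxMin_pos (hs.relax_mem k)).le
    have h2 := hs.rowMin_step_pos k
    have h3 := hs.rowMin_reg_pos k
    have h4 := hq0 k
    simp only [hb]
    positivity
  obtain ⟨k₀, hk₀⟩ := eventually_atTop.1 (hs.eventually_small (ℓ + E₀) S')
  have hm := history_le hsamp.measurable_w hsamp.measurable_vs
  have hxm := fun k => hrun.measurable_iterate h hop.measurable_F k
  have hx2 := fun k => hrun.memLp_iterate h hop hX hsamp hs.relax_mem k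
  have hUi : ∀ k (z : Prd n), Integrable (fun ω => ‖x k ω - z‖ ^ 2) P := fun k z =>
    ((hx2 k).sub (memLp_const z)).integrable_norm_pow two_ne_zero
  have hrec : ∀ k, k₀ ≤ k → ∀ A, MeasurableSet[history w vs (k + 1)] A →
      ∫ ω in A, ‖x (k + 2) ω - t (k + 1)‖ ^ 2 ∂P ≤
        ∫ ω in A, ((1 - q (k + 1) / 2) * ‖x (k + 1) ω - t k‖ ^ 2 + b (k + 1)) ∂P := by
    intro k hk A hA
    obtain ⟨hsmall, hq1⟩ := hk₀ (k + 1) (by omega)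
    refine hκstep (t (k + 1)) (ht (k + 1)).1 k A hA
      (fun u => (1 - q (k + 1) / 2) * ‖u - t k‖ ^ 2 + b (k + 1)) (fun u => ?_)
      (((hUi (k + 1) (t k)).const_mul _).add (integrable_const _))
    -- Choosing `p` as the nearest feasible point makes the infeasibility error match the
    -- feasibility gain.
    obtain ⟨p, hp, hpd⟩ := h.exists_norm_sub_sq_eq hX u
    rw [← hpd]
    have h1 := integral_stepEnergy_le hop hX hS (a := α (k + 1)) hE₀0 (hs.abs_reg_le (k + 1)) u
      (t (k + 1))
    have h2 := drift_le hop.monotone hℓ (hs.step_pos (k + 1)) hE₀0 (hs.abs_reg_le (k + 1))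
      (ht (k + 1)) hp (hNt (k + 1)) u
    have h3 : (2 * S + 2 * E₀ ^ 2) * (1 + ‖u‖ ^ 2) ≤ S' * (1 + ‖u - t (k + 1)‖ ^ 2) := by
      rw [hS', mul_assoc]
      refine mul_le_mul_of_nonneg_left ?_ (by positivity)
      have h4 : ‖u‖ ≤ ‖u - t (k + 1)‖ + M := by
        have := norm_le_insert' u (t (k + 1))
        linarith [hM (k + 1)]
      have h5 := pow_le_pow_left₀ (norm_nonneg _) h4 2
      nlinarith [sq_nonneg (‖u - t (k + 1)‖ - M), mul_nonneg (sq_nonneg M)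
        (sq_nonneg ‖u - t (k + 1)‖)]
    have h4 := mul_le_mul_of_nonneg_left h3
      (show 0 ≤ 2 * rowMax (α (k + 1)) ^ 2 by positivity)
    have h5 := energy_sub_gain_le (r := ‖u - t (k + 1)‖) (norm_nonneg (u - p))
      (rowMin_le_rowMax (α (k + 1))) hN0 (hq0 (k + 1))
      (mul_pos hκ (relaxMin_pos (hs.relax_mem (k + 1)))) hsmall
      (h1.trans (show _ ≤ _ by rw [stepReg, stepGap]; linarith))
    have h6 : ‖t (k + 1) - t k‖ ≤ regGap ε (k + 1) / rowMin (ε (k + 1 : ℕ)) * M := by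
      have h7 := mul_norm_sub_le_of_mem_solSet_regOp hop.monotone (rowMin_le (ε (k + 1 : ℕ)))
        ((abs_nonneg _).trans (hs.abs_reg_sub_le k 0)) (hs.abs_reg_sub_le k) (ht (k + 1)) (ht k)
      rw [div_mul_eq_mul_div, le_div_iff₀ (hs.rowMin_reg_pos (k + 1)), mul_comm]
      exact h7.trans (mul_le_mul_of_nonneg_left (hM k)
        ((abs_nonneg _).trans (hs.abs_reg_sub_le k 0)))
    have h7 := contraction_shift_le u (t (k + 1)) (t k) (hq0 (k + 1)) hq1 h6
    have h8 : (stepReg α ε (k + 1))⁻¹ = (rowMin (α (k + 1)))⁻¹ * (rowMin (ε (k + 1 : ℕ)))⁻¹ := by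
      rw [stepReg, mul_inv]
    rw [h8] at h7
    have h9 : N ^ 2 * rowMax (α (k + 1)) ^ 2 / (κ * relaxMin β (k + 1)) =
        N ^ 2 * κ⁻¹ * (rowMax (α (k + 1)) ^ 2 / relaxMin β (k + 1)) := by
      rw [mul_div_mul_comm, div_eq_mul_inv (N ^ 2)]
    rw [h9] at h5
    simp only [hb]
    refine h5.trans ?_
    linarith
  let 𝒢 : Filtration ℕ (inferInstance : MeasurableSpace Ω) :=
    -- The offset `k₀` waits for the step conditions; the extra `1` reflects that `x (k + 1)`,
    -- produced with `ε k`, is paired with `t k`.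
    { seq := fun i => history w vs (k₀ + i + 1)
      mono' := fun i j hij => history_mono (by omega)
      le' := fun i => hm _ }
  have hmain := ae_tendsto_zero_of_almost_supermartingale (P := P) 𝒢
    (U := fun i ω => ‖x (k₀ + i + 1) ω - t (k₀ + i)‖ ^ 2) (a := fun i => q (k₀ + i + 1) / 2)
    (b := fun i => b (k₀ + i + 1)) (fun _ _ => sq_nonneg _)
    (fun i => ((continuous_id.sub continuous_const).norm.pow 2).measurable.comp
      (hxm (k₀ + i + 1)))
    (fun i => hUi _ _) (fun i => (half_pos (hq0 _)).le) (fun i => hb0 _)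
    (by simpa only [Nat.add_assoc, Nat.add_comm, Nat.add_left_comm] using
      (summable_nat_add_iff (k₀ + 1)).2 hbs) ?_
    (fun i A hA => hrec (k₀ + i) (by omega) A hA)
  · filter_upwards [hmain] with ω hω
    refine (tendsto_add_atTop_iff_nat k₀).1 (hω.congr fun i => ?_)
    rw [Nat.add_comm k₀ i]
  · have h1 := ((tendsto_add_atTop_iff_nat (k₀ + 1)).2 hs.sum_stepReg).atTop_add
      (tendsto_const_nhds (x := -∑ k ∈ Finset.range (k₀ + 1), stepReg α ε k))
    refine (h1.atTop_mul_const (half_pos one_pos)).congr fun N => ?_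
    rw [Nat.add_comm N, Finset.sum_range_add, add_assoc, add_comm, add_assoc, neg_add_cancel,
      add_zero, Finset.sum_mul]
    refine Finset.sum_congr rfl fun i _ => ?_
    rw [show k₀ + 1 + i = k₀ + i + 1 by omega]
    ring

end Convergence

end CartesianSVI

/-! ### Combining the Tikhonov trajectory with the tracking result -/

open CartesianSVI
theorem theorem4p1 {m : ℕ} [NeZero m] (n : Fin m → ℕ)
    {Ω : Type*} [MeasurableSpace Ω] (P : Measure Ω) [IsProbabilityMeasure P]
    {Ξ : Fin m → Type*} [∀ j, MeasurableSpace (Ξ j)]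
    {I : Fin m → Type*} [∀ j, MeasurableSpace (I j)]
    (X₀ : ∀ j, Set (Block n j)) (g : ∀ j, I j → Block n j → EReal)
    (F : ∀ j, Ξ j → Prd n → Block n j)
    (v : Ω → ∀ j, Ξ j) (vs : ℕ → Ω → ∀ j, Ξ j) (w : ℕ → Ω → ∀ j, I j)
    (α β : ℕ → Fin m → ℝ) (ε : ℤ → Fin m → ℝ)
    (x0 : Prd n) (x y d : ℕ → Ω → Prd n)
    (hconstr : ConstraintStructure X₀ g)
    (hop : OperatorAssumption P v F (feasSet X₀ g))
    (hsol : (solSet (meanOp P v F) (feasSet X₀ g)).Nonempty)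
    (hsamp : SamplingAssumption P v vs w)
    (hreg : RegularityAssumption P X₀ g w vs)
    (hstep : StepAssumption α β ε)
    (hrun : IsRun X₀ g F α β ε w vs x0 x y d) :
    (limsup (fun k : ℕ => ((rowMax (ε k) / rowMin (ε k) : ℝ) : EReal)) atTop < ⊤ →
      ∀ᵐ ω ∂P, Bornology.IsBounded (Set.range (fun k => x k ω)) ∧
        ∀ z, MapClusterPt z atTop (fun k => x k ω) →
          z ∈ solSet (meanOp P v F) (feasSet X₀ g)) ∧
    (limsup (fun k : ℕ => ((rowMax (ε k) / rowMin (ε k) : ℝ) : EReal)) atTop ≤ 1 →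
      ∃ z, IsLeastNorm (solSet (meanOp P v F) (feasSet X₀ g)) z ∧
        (∀ z', IsLeastNorm (solSet (meanOp P v F) (feasSet X₀ g)) z' → z' = z) ∧
        ∀ᵐ ω ∂P, Tendsto (fun k => x k ω) atTop (𝓝 z)) := by
  have hX : (feasSet X₀ g).Nonempty := hsol.mono fun _ h => h.1
  have hcl := hconstr.isClosed_feasSet
  have hconv := hconstr.convex_feasSet
  obtain ⟨ℓ, hℓ0, hℓ⟩ := hop.meanOp_lipschitz
  have hT : Continuous (meanOp P v F) :=
    (LipschitzWith.of_dist_le_mul (K := ℓ.toNNReal) fun a b => by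
      rw [dist_eq_norm, dist_eq_norm, Real.coe_toNNReal _ hℓ0]
      exact hℓ b a).continuous
  have hex : ∀ k : ℕ, (solSet (regOp (meanOp P v F) (ε k)) (feasSet X₀ g)).Nonempty := fun k =>
    solSet_nonempty_of_strongly_monotone hX hcl hconv (hstep.rowMin_reg_pos k)
      (regOp_lipschitz hℓ ((abs_nonneg _).trans (hstep.abs_reg_le 0 0)) (hstep.abs_reg_le k))
      (regOp_strongly_monotone hop.monotone (rowMin_le (ε k)))
  choose t ht using hex
  have hpos : ∀ (k : ℕ) j, 0 < ε k j := fun k => hstep.reg_pos k (by omega)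
  have hbdd : limsup (fun k : ℕ => ((rowMax (ε k) / rowMin (ε k) : ℝ) : EReal)) atTop < ⊤ →
      ∃ M, ∀ k, ‖t k‖ ≤ M := by
    intro hlim
    obtain ⟨r, hr, -⟩ := EReal.lt_iff_exists_real_btwn.1 hlim
    have hev : ∀ᶠ k : ℕ in atTop, rowMax (ε k) / rowMin (ε k) ≤ r :=
      (eventually_lt_of_limsup_lt hr).mono fun k hk => (EReal.coe_lt_coe_iff.1 hk).le
    -- An eventual bound on a real sequence is upgraded to a bound for all indices.
    obtain ⟨R, hR⟩ := (Filter.isBoundedUnder_of_eventually_le hev).bddAbove_range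
    obtain ⟨xs, hxs⟩ := hsol
    refine ⟨√(R * ‖xs‖ ^ 2), fun k => Real.le_sqrt_of_sq_le ?_⟩
    have h1 := norm_sq_le_of_mem_solSet_regOp hop.monotone (fun j => (hpos k j).le)
      (rowMin_le (ε k)) (le_rowMax (ε k)) (ht k) hxs
    have hmin := hstep.rowMin_reg_pos k
    have h2 : rowMax (ε k) ≤ R * rowMin (ε k) :=
      (div_le_iff₀ hmin).1 (hR (Set.mem_range_self k))
    have h3 := mul_le_mul_of_nonneg_right h2 (sq_nonneg ‖xs‖)
    refine le_of_mul_le_mul_left (h1.trans (h3.trans (le_of_eq ?_))) hmin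
    ring
  have hconvg : ∀ M, (∀ k, ‖t k‖ ≤ M) →
      ∀ᵐ ω ∂P, Tendsto (fun k => x (k + 1) ω - t k) atTop (𝓝 0) := by
    intro M hM
    filter_upwards [hrun.ae_tendsto_norm_sub_sq hconstr hop hsamp hreg hstep ht hM] with ω hω
    rw [tendsto_zero_iff_norm_tendsto_zero]
    simpa using hω.sqrt
  refine ⟨fun hlim => ?_, fun hlim => ?_⟩
  · obtain ⟨M, hM⟩ := hbdd hlim
    filter_upwards [hconvg M hM] with ω hω
    constructor
    · obtain ⟨C, hC⟩ := isBounded_iff_forall_norm_le.1 (Metric.isBounded_range_of_tendsto _ hω)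
      refine isBounded_iff_forall_norm_le.2 ⟨max ‖x 0 ω‖ (C + M), ?_⟩
      rintro _ ⟨k, rfl⟩
      cases k with
      | zero => exact le_max_left _ _
      | succ k =>
        refine le_max_of_le_right ?_
        have h1 := hC _ (Set.mem_range_self k)
        have h2 := norm_le_insert' (x (k + 1) ω) (t k)
        linarith [hM k]
    · intro z hz
      have hz' : MapClusterPt z atTop fun k => x (k + 1) ω := by
        rw [MapClusterPt, ← map_add_atTop_eq_nat 1] at hz
        exact hz
      obtain ⟨φ, hφ, hφz⟩ := hz'.tendsto_subseq
      -- Since the tracking error vanishes, cluster points of the iterates are cluster points of the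
      -- Tikhonov trajectory.
      have htz : Tendsto (t ∘ φ) atTop (𝓝 z) := by
        simpa [Function.comp_def] using hφz.sub (hω.comp hφ.tendsto_atTop)
      exact mem_solSet_of_mapClusterPt hcl hT hstep.reg_tendsto_nat ht
        (htz.mapClusterPt.of_comp hφ.tendsto_atTop)
  · obtain ⟨M, hM⟩ := hbdd (hlim.trans_lt (EReal.coe_lt_top 1))
    obtain ⟨z, hz, hzu⟩ := existsUnique_isLeastNorm hsol (isClosed_solSet hcl hT)
      (convex_solSet hconv hT hop.monotone)
    have htz : Tendsto t atTop (𝓝 z) :=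
      tendsto_isLeastNorm_of_solSet_regOp hcl hconv hT hop.monotone hpos hstep.reg_tendsto_nat ht
        hM (fun q hq => (eventually_lt_of_limsup_lt
          (hlim.trans_lt (EReal.coe_lt_coe_iff.2 hq))).mono fun k hk =>
            EReal.coe_lt_coe_iff.1 hk) hz
    refine ⟨z, hz, hzu, ?_⟩
    filter_upwards [hconvg M hM] with ω hω
    refine (tendsto_add_atTop_iff_nat 1).1 ?_
    simpa using hω.add htz
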